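/- Let $p,q$ be primes and $k\ge 1$ an integer; put $n=kq+1$ and assume $p>n$. Let $a_1$ be the integer with $1\le a_1<q$ and $a_1p\equiv 1 \pmod q$. **Arithmetic solutions.** Let $\bar M$ be the least positive integer with $\bar M\equiv -1/q \pmod p$. For $1\le j\le n$ write $$P_j(x,z)=\frac{1}{x-z_j}\prod_{i=1}^n (x-z_i)^{\bar M}=\sum_i P_j^i(z)\,x^i,\qquad P_j^i(z)\in\mathbb F_p[z]=\mathbb F_p[z_1,\dots,z_n],$$ and $P^i(z)=(P^i_1(z),\dots,P^i_n(z))$. The module of arithmetic solutions $\mathcal M_\Lambda$, $\Lambda=(1,\dots,1)$, is the $\mathbb F_p[z_1^p,\dots,z_n^p]$-submodule of $\mathbb F_p[z]^n$ generated by all $P^{lp-1}(z)$, $l\ge 1$. For $1\le m\le a_1k$ put $I^m(z)=P^{(a_1k-m)p+p-1}(z)$. **The curve.** Let $\mathbb K(z)$ be the field of rational functions over $\mathbb F_p$ in the variables $z_i^{1/p^s}$ ($1\le i\le n$, $s\ge 0$), that is, the perfect closure of $\mathbb F_p(z_1,\dots,z_n)$. Let $\sigma(f)=f^p$ be its Frobenius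 automorphism and $\tau=\sigma^{-1}$. Let $X$ be the curve $y^q=\prod_{i=1}^n(x-z_i)$ over $\mathbb K(z)$. Let $\Omega^1_{a_1}(X)$ be the space of regular $1$-forms on $X$ of the shape $u(x)\,dx/y^{a_1}$, $u$ a polynomial. Let $W(X)$ be the $\mathbb K(z)$-span of the $1$-forms $w_j=\frac{1}{x-z_j}\frac{dx}{y}$, $1\le j\le n$. **Statement.** The forms $w_j$ are a basis of $W(X)$, and the forms $x^{a_1k-m}dx/y^{a_1}$, $1\le m\le a_1k$, are a basis of $\Omega^1_{a_1}(X)$. Let $(\psi_j)$ and $(\phi^m_{a_1})$ be the respective dual bases of $W(X)^*$ and $\Omega^1_{a_1}(X)^*$. Let $\hat C:W(X)\to\Omega^1_{a_1}(X)$ be the Cartier map, the $\tau$-linear map with $$\hat C(w_j)=\sum_{h=1}^{a_1k}\big(P_j^{(a_1k-h)p+p-1}(z)\big)^{1/p}\,x^{a_1k-h}\frac{dx}{y^{a_1}},$$ and let $\hat C^*:\Omega^1_{a_1}(X)^*\to W(X)^*$ be its $\sigma$-linear adjoint, $\hat C^*(\phi)(w)=\big(\phi(\hat C(w))\big)^p$.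 Identify $v\in\mathbb F_p[z]^n$ with $\sum_j v_j\psi_j\in W(X)^*$; in particular $\mathcal M_\Lambda\subset W(X)^*$. Then: 1. $\hat C^*(\phi^m_{a_1})=I^m(z)$ for $m=1,\dots,a_1k$. 2. $\mathcal M_\Lambda$ is a free $\mathbb F_p[z_1^p,\dots,z_n^p]$-module with basis $I^1(z),\dots,I^{a_1k}(z)$, so that $\operatorname{rank}\mathcal M_\Lambda=\dim\Omega^1_{a_1}(X)^*=a_1k$. 3. $\hat C^*$ defines an isomorphism $\iota_\Lambda:\phi^m_{a_1}\mapsto I^m(z)$ between $\Omega^1_{a_1}(X)^*$ and $\mathcal M_\Lambda$, in the following sense: it is a $\sigma$-linear isomorphism of $\Omega^1_{a_1}(X)^*$ onto the $\mathbb K(z)$-span of $\mathcal M_\Lambda$ in $W(X)^*$, and it restricts to a bijection of $\bigoplus_m\mathbb F_p[z]\,\phi^m_{a_1}$ onto $\mathcal M_\Lambda$. -/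

import Mathlib

open Polynomial
open scoped KaehlerDifferential

noncomputable section

namespace ArithSol

/-! ### Semilinear algebra -/

section Semilinear

variable {K V W : Type*} [Field K] [AddCommGroup V] [Module K V] [AddCommGroup W] [Module K W]

/-- The `τ`-linear map `W → V` with prescribed values `v i` on the vectors of a basis `w` of `W`:
it sends `∑ cᵢ wᵢ` to `∑ τ(cᵢ) vᵢ`. -/
def semilinearOfBasis {ι : Type*} [Fintype ι] (τ : K →+* K) (w : Module.Basis ι K W) (v : ι → V) :
    W →ₛₗ[τ] V where
  toFun x := ∑ i, τ (w.repr x i) • v i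
  map_add' x y := by simp [add_smul, Finset.sum_add_distrib]
  map_smul' c x := by simp [mul_smul, Finset.smul_sum]

theorem semilinearOfBasis_apply {ι : Type*} [Fintype ι] (τ : K →+* K) (w : Module.Basis ι K W)
    (v : ι → V) (i : ι) : semilinearOfBasis τ w v (w i) = v i := by
  classical
  simp [semilinearOfBasis, Finsupp.single_apply, apply_ite τ, ite_smul]

/-- The adjoint of a `τ`-linear map `f : W → V`, with `σ = τ⁻¹`: the `σ`-linear map
`f* : V* → W*` given by `(w, f*(φ)) = σ (f(w), φ)`. -/
def semilinearAdjoint {σ τ : K →+* K} [RingHomInvPair τ σ] (f : W →ₛₗ[τ] V) :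
    Module.Dual K V →ₛₗ[σ] Module.Dual K W where
  toFun φ :=
    { toFun := fun w => σ (φ (f w))
      map_add' := fun x y => by simp
      map_smul' := fun c x => by simp }
  map_add' φ ψ := by ext x; simp
  map_smul' c φ := by ext x; simp

end Semilinear

/-! ### Arithmetic solutions -/

section Solutions

variable (p : ℕ) {n : ℕ}

/-- The polynomial ring `𝔽_p[z₁, …, zₙ]`. -/
abbrev Fz (p n : ℕ) : Type := MvPolynomial (Fin n) (ZMod p)

/-- The subring `𝔽_p[z^p] = 𝔽_p[z₁^p, …, zₙ^p]` of `𝔽_p[z]`. -/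
def Fzp (p n : ℕ) : Subalgebra (ZMod p) (Fz p n) :=
  Algebra.adjoin (ZMod p) (Set.range fun i : Fin n => (MvPolynomial.X i : Fz p n) ^ p)

instance : CommRing (Fzp p n) := Subalgebra.toCommRing _

instance (S : Submodule (Fzp p n) (Fin n → Fz p n)) : Module (Fzp p n) S := Submodule.module S

instance (S : Submodule (Fzp p n) (Fin n → Fz p n)) : SMul (Fzp p n) S :=
  (Submodule.module S).toSMul

/-- The polynomial `P_j(t, z, M) = (t - z_j)⁻¹ ∏ᵢ (t - zᵢ)^{Mᵢ}` in `t` over `𝔽_p[z]`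
(for positive exponents `Mᵢ`). -/
def Pcoord (M : Fin n → ℕ) (j : Fin n) : Polynomial (Fz p n) :=
  (X - C (MvPolynomial.X j)) ^ (M j - 1) *
    ∏ i ∈ Finset.univ.erase j, (X - C (MvPolynomial.X i)) ^ M i

/-- The vector `P^i(z, M)` of coefficients of `t^i` in `P(t, z, M)`. -/
def Pvec (M : Fin n → ℕ) (i : ℕ) : Fin n → Fz p n := fun j => (Pcoord p M j).coeff i

/-- The vector `M̄`: `M̄ᵢ` is the least positive integer congruent to `-Λᵢ/q` modulo `p`. -/
def Mbar (q : ℕ) [Fact p.Prime] (Λ : Fin n → ℕ) (i : Fin n) : ℕ :=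
  sInf {m : ℕ | 0 < m ∧ (m : ZMod p) = -(Λ i : ZMod p) / (q : ZMod p)}

/-- The module `M_Λ` of arithmetic solutions: the `𝔽_p[z^p]`-module generated by the vectors
`P^{lp-1}(z, M̄)`, `l ≥ 1`. -/
def solModule (q : ℕ) [Fact p.Prime] (Λ : Fin n → ℕ) : Submodule (Fzp p n) (Fin n → Fz p n) :=
  Submodule.span (Fzp p n) {v | ∃ l : ℕ, 1 ≤ l ∧ v = Pvec p (Mbar p q Λ) (l * p - 1)}

/-- The arithmetic solution `I^m(z) = P^{(a₁k-m)p+p-1}(z, M̄)` for `Λ = (1, …, 1)`,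
`n = kq + 1`. -/
def Isol (q k a₁ : ℕ) [Fact p.Prime] (m : ℕ) : Fin (k * q + 1) → Fz p (k * q + 1) :=
  Pvec p (Mbar p q fun _ => 1) ((a₁ * k - m) * p + p - 1)

end Solutions

/-! ### The field `𝕂(z)` -/

section BaseField

variable (p n : ℕ) [Fact p.Prime]

/-- The field `𝕂(z)` of rational functions over `𝔽_p` in the variables `zᵢ^{1/p^s}`:
the perfect closure of `𝔽_p(z₁, …, zₙ)`. -/
def Kz : Type := PerfectClosure (FractionRing (Fz p n)) p

instance : Field (Kz p n) :=
  inferInstanceAs (Field (PerfectClosure (FractionRing (Fz p n)) p))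

instance : CharP (Kz p n) p :=
  inferInstanceAs (CharP (PerfectClosure (FractionRing (Fz p n)) p) p)

instance : PerfectRing (Kz p n) p :=
  inferInstanceAs (PerfectRing (PerfectClosure (FractionRing (Fz p n)) p) p)

/-- The inclusion `𝔽_p[z] → 𝕂(z)`. -/
def toKz : Fz p n →+* Kz p n :=
  (PerfectClosure.of (FractionRing (Fz p n)) p).comp (algebraMap (Fz p n) (FractionRing (Fz p n)))

/-- The Frobenius automorphism `σ : f ↦ f^p` of `𝕂(z)`. -/
def σ : Kz p n →+* Kz p n := (frobeniusEquiv (Kz p n) p : Kz p n →+* Kz p n)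

/-- The inverse `τ : f ↦ f^{1/p}` of the Frobenius automorphism of `𝕂(z)`. -/
def τ : Kz p n →+* Kz p n := ((frobeniusEquiv (Kz p n) p).symm : Kz p n →+* Kz p n)

instance : RingHomInvPair (σ p n) (τ p n) := RingHomInvPair.of_ringEquiv _

instance : RingHomInvPair (τ p n) (σ p n) := RingHomInvPair.of_ringEquiv_symm _

end BaseField

/-! ### The curve `X : y^q = (x - z₁) ⋯ (x - zₙ)`, `n = kq + 1` -/

section Curve

variable (p q k : ℕ) [Fact p.Prime]

/-- The base field of the curve. -/
abbrev 𝕂 : Type := Kz p (k * q + 1)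

/-- The element `z_i` of the base field. -/
def z (i : Fin (k * q + 1)) : 𝕂 p q k := toKz p (k * q + 1) (MvPolynomial.X i)

/-- `F(x, z) = ∏ᵢ (x - zᵢ)`. -/
def F : (𝕂 p q k)[X] := ∏ i, (X - C (z p q k i))

/-- The polynomial `Y^q - F(x, z)` over the field of rational functions in `x`. -/
def curvePoly : (RatFunc (𝕂 p q k))[X] :=
  X ^ q - C (algebraMap (𝕂 p q k)[X] (RatFunc (𝕂 p q k)) (F p q k))

theorem curvePoly_irreducible [hq : Fact q.Prime] : Irreducible (curvePoly p q k) := by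
  refine X_pow_sub_C_irreducible_of_prime hq.out fun b hb => ?_
  have hpow : ∀ (b : RatFunc (𝕂 p q k)) (_ : b ≠ 0) (m : ℕ),
      (b ^ m).intDegree = m * b.intDegree := by
    intro b h0 m
    induction m with
    | zero => simp
    | succ m ih =>
      rw [pow_succ, RatFunc.intDegree_mul (pow_ne_zero _ h0) h0, ih]
      push_cast
      ring
  have hF : (F p q k).natDegree = k * q + 1 := by
    rw [F, natDegree_prod_of_monic _ _ fun i _ => monic_X_sub_C _]
    simp
  have hF0 : F p q k ≠ 0 := by
    intro h
    rw [h, natDegree_zero] at hF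
    omega
  have h0 : b ≠ 0 := by
    rintro rfl
    rw [zero_pow hq.out.ne_zero] at hb
    exact hF0 (RatFunc.algebraMap_injective _ (by rw [← hb, map_zero]))
  have hd := congrArg RatFunc.intDegree hb
  rw [hpow b h0, RatFunc.intDegree_polynomial, hF] at hd
  push_cast at hd
  have h1 : (q : ℤ) ∣ 1 := ⟨b.intDegree - k, by linarith⟩
  have h2 : q ∣ 1 := by exact_mod_cast h1
  exact hq.out.one_lt.ne' (Nat.dvd_one.1 h2)

instance [Fact q.Prime] : Fact (Irreducible (curvePoly p q k)) := ⟨curvePoly_irreducible p q k⟩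

/-- The function field `𝕂(z)(x)[y] / (y^q - F(x, z))` of the curve `X`. -/
abbrev FunField [Fact q.Prime] : Type := AdjoinRoot (curvePoly p q k)

variable [Fact q.Prime]

/-- The coordinate function `x` on `X`. -/
def x : FunField p q k := AdjoinRoot.of (curvePoly p q k) RatFunc.X

/-- The coordinate function `y` on `X`. -/
def y : FunField p q k := AdjoinRoot.root (curvePoly p q k)

/-- The space of rational 1-forms on `X`. -/
abbrev Forms : Type := Ω[FunField p q k⁄𝕂 p q k]

/-- The rational 1-form `dx`. -/
def dx : Forms p q k := KaehlerDifferential.D (𝕂 p q k) (FunField p q k) (x p q k)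

/-- The 1-forms regular at the place of `X` with valuation ring `O`: the `O`-module generated by
the differentials `dg`, `g ∈ O` (as `O` contains the base field, it is the span over the base
field of the forms `f dg` with `f, g ∈ O`). -/
def regularAt (O : ValuationSubring (FunField p q k)) : Submodule (𝕂 p q k) (Forms p q k) :=
  Submodule.span (𝕂 p q k) {ω | ∃ f ∈ O, ∃ g ∈ O,
    ω = f • KaehlerDifferential.D (𝕂 p q k) (FunField p q k) g}

/-- The space `Ω¹(X)` of regular 1-forms: the rational 1-forms that are regular at all places,
that is, at all valuation rings of the function field containing the base field. -/
def Omega : Submodule (𝕂 p q k) (Forms p q k) :=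
  ⨅ (O : ValuationSubring (FunField p q k))
    (_ : ∀ c : 𝕂 p q k, algebraMap (𝕂 p q k) (FunField p q k) c ∈ O), regularAt p q k O

/-- The space `Ω¹_a(X)` of regular 1-forms of the shape `u(x) dx / y^a`, `u` a polynomial. -/
def OmegaEig (a : ℕ) : Submodule (𝕂 p q k) (Forms p q k) where
  carrier := {ω | ω ∈ Omega p q k ∧
    ∃ u : (𝕂 p q k)[X], ω = (aeval (x p q k) u / y p q k ^ a) • dx p q k}
  zero_mem' := ⟨zero_mem _, 0, by simp⟩
  add_mem' := by
    rintro _ _ ⟨h, u, rfl⟩ ⟨h', u', rfl⟩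
    exact ⟨add_mem h h', u + u', by rw [map_add, add_div, add_smul]⟩
  smul_mem' := by
    rintro c _ ⟨h, u, rfl⟩
    exact ⟨Submodule.smul_mem _ c h, c • u, by rw [map_smul, smul_div_assoc, smul_assoc]⟩

/-- The 1-form `x^i dx / y^a`. -/
def omegaForm (a i : ℕ) : Forms p q k := (x p q k ^ i / y p q k ^ a) • dx p q k

/-- The 1-form `(x - z_j)⁻¹ dx / y`. -/
def wForm (j : Fin (k * q + 1)) : Forms p q k :=
  ((x p q k - algebraMap (𝕂 p q k) (FunField p q k) (z p q k j))⁻¹ / y p q k) • dx p q k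

/-- The space `W(X)` spanned by the 1-forms `(x - z_j)⁻¹ dx / y`. -/
def W : Submodule (𝕂 p q k) (Forms p q k) := Submodule.span (𝕂 p q k) (Set.range (wForm p q k))

variable {p q k}

/-- The `τ`-linear Cartier map `Ĉ : W(X) → Ω¹_{a₁}(X)`. Here `w` stands for the basis
`(x - z_j)⁻¹ dx / y` of `W(X)` and `b` for the basis of `Ω¹_{a₁}(X)` whose `h`-th vector is
`x^{a₁k-h} dx / y^{a₁}` (`1 ≤ h ≤ a₁k`; the index is `h - 1` in `Fin (a₁ * k)`). As
`(x - z_j)⁻¹ dx / y = P_j(x, z, M̄) dx / y^{a₁p}`, the map sends `w j` to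
`∑_h (P_j^{(a₁k-h)p+p-1}(z, M̄))^{1/p} b_h`. -/
def cartierMap {a₁ : ℕ} (w : Module.Basis (Fin (k * q + 1)) (𝕂 p q k) (W p q k))
    (b : Module.Basis (Fin (a₁ * k)) (𝕂 p q k) (OmegaEig p q k a₁)) :
    W p q k →ₛₗ[τ p (k * q + 1)] OmegaEig p q k a₁ :=
  semilinearOfBasis (τ p (k * q + 1)) w fun j =>
    ∑ h : Fin (a₁ * k), τ p (k * q + 1) (toKz p (k * q + 1)
      (Pvec p (Mbar p q fun _ => 1) ((a₁ * k - (h + 1)) * p + p - 1) j)) • b h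

/-- The element `∑_j v_j ψ_j` of `W(X)*` with coordinate vector `v ∈ 𝔽_p[z]ⁿ`, where `(ψ_j)` is
the basis dual to the basis `w` of `W(X)`. -/
def ofCoord (w : Module.Basis (Fin (k * q + 1)) (𝕂 p q k) (W p q k))
    (v : Fin (k * q + 1) → Fz p (k * q + 1)) : Module.Dual (𝕂 p q k) (W p q k) :=
  ∑ j, toKz p (k * q + 1) (v j) • w.coord j

end Curve

end ArithSol

end

open scoped LaurentSeries PowerSeries

noncomputable section

namespace ArithSol

/-! ### Laurent series, and a formal point at infinity of `y^q = f(x)`. -/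

section Laurent

universe u

variable {K : Type u} [Field K]

/-! Write `n = kq + 1` and let `M` be defined by `qM + 1 = a₁p`; then `k < M < p` and `M` is the
common entry of `Mbar`. Since `nM = a₁kp + (M - k)`, the degree `nM - 1` of `P_j` is below `(a₁k +
1)p - 1`, so only `l ≤ a₁k` contribute and the `I^m` generate the module of solutions. As `στ = 1`,
the adjoint sends `φ` to `∑ σ(φ(b_m)) I^m`. Over `𝔽_p` the elements of `𝔽_p[z^p]` are exactly the
`p`-th powers, so this map carries `𝔽_p[z]`-combinations onto solutions. Two facts remain: the forms
are bases, and the `I^m` are linearly independent over `𝕂(z)`.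

Bases. At finite places separability of `F` exhibits `x^i dx/y^a` as regular; at infinity `x^k/y`
serves as parameter (`omegaForm_mem_regularAt_of_mem`, `omegaForm_mem_regularAt_of_notMem`).
Conversely, expanding at infinity with `x = t⁻ᵠ` bounds the degree of `u` in a regular form
(`natDegree_lt_of_mem_Omega`).

Independence (`linearIndependent_toKz_Pvec`). A relation `∑ c_m I^m = 0` is encoded by a polynomial
`G` in `x^p`: all coefficients of `F^(M-1) G` in a window of length `n` just below `x^(a₁kp)`
vanish. Since `G' = 0`, the product satisfies a first-order differential equation, which the gap
splits into an upper and a lower part. The upper part is divisible by `F^(M-1)`, hence zero by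
degree; then the whole product has too small a degree unless `G = 0`
(`eq_zero_of_coeff_pow_mul_eq_zero`). -/

/-- The operator `t d/dt` on Laurent series in `t`. -/
def eulerOperator (f : K⸨X⸩) : K⸨X⸩ where
  coeff m := (m : K) * f.coeff m
  isPWO_support' := f.isPWO_support.mono fun m hm => by
    simp only [Function.mem_support, HahnSeries.mem_support] at hm ⊢
    exact right_ne_zero_of_mul hm

theorem coeff_eulerOperator (f : K⸨X⸩) (m : ℤ) :
    (eulerOperator f).coeff m = m * f.coeff m := rfl

theorem support_eulerOperator_subset (f : K⸨X⸩) : (eulerOperator f).support ⊆ f.support :=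
  fun m hm => by
    simp only [HahnSeries.mem_support, coeff_eulerOperator] at hm ⊢
    exact right_ne_zero_of_mul hm

theorem eulerOperator_mul (f g : K⸨X⸩) :
    eulerOperator (f * g) = f * eulerOperator g + g * eulerOperator f := by
  ext m
  -- All three convolutions are summed over the antidiagonal of the supports of `f` and `g`; then
  -- the identity is `m = i + j` term by term.
  rw [mul_comm g, HahnSeries.coeff_add, coeff_eulerOperator, HahnSeries.coeff_mul,
    HahnSeries.coeff_mul_right' g.isPWO_support (support_eulerOperator_subset g),
    HahnSeries.coeff_mul_left' f.isPWO_support (support_eulerOperator_subset f),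
    Finset.mul_sum, ← Finset.sum_add_distrib]
  refine Finset.sum_congr rfl fun ij hij => ?_
  have h : ij.1 + ij.2 = m := by
    simp only [Finset.mem_antidiagonal] at hij
    exact hij.2.2
  rw [coeff_eulerOperator, coeff_eulerOperator, ← h]
  push_cast
  ring

theorem eulerOperator_add (f g : K⸨X⸩) :
    eulerOperator (f + g) = eulerOperator f + eulerOperator g := by
  ext m
  simp only [coeff_eulerOperator, HahnSeries.coeff_add, mul_add]

theorem eulerOperator_single_zero (c : K) : eulerOperator (HahnSeries.single 0 c) = 0 := by
  ext m
  rw [coeff_eulerOperator]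
  rcases eq_or_ne m 0 with rfl | hm
  · simp
  · rw [HahnSeries.coeff_single_of_ne hm]; simp

theorem eulerOperator_single_one (c : K) :
    eulerOperator (HahnSeries.single 1 c) = HahnSeries.single 1 c := by
  ext m
  rw [coeff_eulerOperator]
  rcases eq_or_ne m 1 with rfl | hm
  · simp
  · rw [HahnSeries.coeff_single_of_ne hm]; simp

/-- An additive map satisfying the Leibniz rule and killing the base ring, as a derivation. -/
def derivationOfLeibniz {R A : Type*} [CommRing R] [CommRing A] [Algebra R A] (D : A → A)
    (hadd : ∀ f g, D (f + g) = D f + D g) (hmul : ∀ f g, D (f * g) = f * D g + g * D f)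
    (hconst : ∀ c, D (algebraMap R A c) = 0) : Derivation R A A :=
  Derivation.mk'
    { toFun := D
      map_add' := hadd
      map_smul' := fun c f => by simp [Algebra.smul_def, hmul, hconst] }
    hmul

theorem derivationOfLeibniz_apply {R A : Type*} [CommRing R] [CommRing A] [Algebra R A] (D : A → A)
    (hadd : ∀ f g, D (f + g) = D f + D g) (hmul : ∀ f g, D (f * g) = f * D g + g * D f)
    (hconst : ∀ c, D (algebraMap R A c) = 0) (f : A) :
    derivationOfLeibniz D hadd hmul hconst f = D f := rfl

/-- A power series with constant coefficient `1` has a `q`-th root when `q` is invertible. -/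
theorem exists_pow_eq_of_constantCoeff_eq_one {q : ℕ} (hq : (q : K) ≠ 0) (h : K⟦X⟧)
    (h1 : PowerSeries.constantCoeff h = 1) :
    ∃ g : K⟦X⟧, g ^ q = h ∧ PowerSeries.constantCoeff g = 1 := by
  have hq0 : q ≠ 0 := by rintro rfl; simp at hq
  -- Hensel's lemma for `Y^q - h` at the approximate root `1` modulo `X`, where the derivative is
  -- the unit `q`.
  obtain ⟨g, hg, hg'⟩ := HenselianRing.is_henselian (I := Ideal.span {(PowerSeries.X : K⟦X⟧)})
    (X ^ q - C h) (monic_X_pow_sub_C h hq0) 1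
    (by simp [Ideal.mem_span_singleton, PowerSeries.X_dvd_iff, h1])
    (by
      have : IsUnit (q : K⟦X⟧) := by
        rw [PowerSeries.isUnit_iff_constantCoeff]; simpa using hq
      have h' : eval 1 (derivative (X ^ q - C h)) = (q : K⟦X⟧) := by simp [derivative_X_pow]
      rw [h']
      exact this.map (Ideal.Quotient.mk (Ideal.span {(PowerSeries.X : K⟦X⟧)})))
  refine ⟨g, ?_, ?_⟩
  · simpa [IsRoot, sub_eq_zero] using hg
  · simpa [Ideal.mem_span_singleton, PowerSeries.X_dvd_iff, sub_eq_zero] using hg'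

/-- The value of a polynomial at `t⁻ᵠ` has the order predicted by its degree. -/
theorem exists_aeval_single (q : ℕ) (hq : 0 < q) (u : K[X]) :
    ∃ h : K⟦X⟧, PowerSeries.constantCoeff h = u.leadingCoeff ∧
      aeval (HahnSeries.single (-q : ℤ) (1 : K) : K⸨X⸩) u =
        HahnSeries.single (-(q * u.natDegree) : ℤ) (1 : K) * (h : K⸨X⸩) := by
  let _ : Invertible (HahnSeries.single (-q : ℤ) (1 : K) : K⸨X⸩) :=
    ⟨HahnSeries.single (q : ℤ) (1 : K), by simp, by simp⟩
  -- `u(t⁻ᵠ)` is `t^(-q deg u)` times the reversed polynomial at `t^q`.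
  refine ⟨aeval (PowerSeries.X ^ q) u.reverse, ?_, ?_⟩
  · have : PowerSeries.constantCoeff (aeval (PowerSeries.X ^ q : K⟦X⟧) u.reverse) =
        eval₂ (RingHom.id K) 0 u.reverse := by
      rw [aeval_def, hom_eval₂]
      congr 1
      simp [hq.ne']
    rw [this, eval₂_id, ← coeff_zero_eq_eval_zero, coeff_zero_reverse]
  · have := eval₂_reverse_mul_pow (algebraMap K K⸨X⸩)
      (HahnSeries.single (-q : ℤ) (1 : K) : K⸨X⸩) u
    rw [aeval_def, ← this, mul_comm]
    congr 1
    · rw [HahnSeries.single_pow]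
      simp [mul_comm]
    · rw [aeval_def, hom_eval₂]
      congr 1
      ext a
      simp

/-- A point at infinity of the curve `y^q = F(x)`, `F` monic of degree `n`, with values in the field
of Laurent series in `t`: `x = t⁻ᵠ` and `y` has a pole of order `n`. -/
theorem exists_point_at_infinity {q : ℕ} (hq : (q : K) ≠ 0) (f : K[X]) (hf : f.Monic) :
    ∃ (L : Type u) (_ : Field L) (_ : Algebra K L) (D : Derivation K L L)
      (O : ValuationSubring L) (t s : L), t ≠ 0 ∧ t ∈ O ∧ t⁻¹ ∉ O ∧ D t = t ∧
        (∀ c, algebraMap K L c ∈ O) ∧ (∀ g ∈ O, t⁻¹ * D g ∈ O) ∧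
        (∀ u : K[X], u ≠ 0 → ∃ h ∈ O, h ≠ 0 ∧ h⁻¹ ∈ O ∧
          aeval (t ^ (-q : ℤ)) u = t ^ (-(q * u.natDegree) : ℤ) * h) ∧
        s ∈ O ∧ s⁻¹ ∈ O ∧ (t ^ (-f.natDegree : ℤ) * s) ^ q = aeval (t ^ (-q : ℤ)) f := by
  have hq0 : 0 < q := Nat.pos_of_ne_zero (by rintro rfl; simp at hq)
  have hmem : ∀ h : K⟦X⟧, (h : K⸨X⸩) ∈ (Valued.v (R := K⸨X⸩)).valuationSubring := fun h => by
    rw [Valuation.mem_valuationSubring_iff, LaurentSeries.val_le_one_iff_eq_coe]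
    exact ⟨h, rfl⟩
  have hunit : ∀ h : K⟦X⟧, PowerSeries.constantCoeff h ≠ 0 → (h : K⸨X⸩)⁻¹ = (h⁻¹ : K⟦X⟧) := by
    intro h h0
    refine inv_eq_of_mul_eq_one_left ?_
    rw [← PowerSeries.coe_mul, PowerSeries.inv_mul_cancel h h0, PowerSeries.coe_one]
  have ht : ∀ m : ℤ, (HahnSeries.single 1 1 : K⸨X⸩) ^ m = HahnSeries.single m 1 :=
    fun m => (RatFunc.single_zpow m).symm
  obtain ⟨h, h1, hh⟩ := exists_aeval_single q hq0 f
  obtain ⟨g, hg, hg1⟩ := exists_pow_eq_of_constantCoeff_eq_one hq h (h1.trans hf)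
  refine ⟨K⸨X⸩, inferInstance, inferInstance,
    derivationOfLeibniz eulerOperator eulerOperator_add eulerOperator_mul fun c => by
      rw [LaurentSeries.algebraMap_apply, HahnSeries.C_apply, eulerOperator_single_zero],
    (Valued.v (R := K⸨X⸩)).valuationSubring, HahnSeries.single 1 1, g, by simp, ?_, ?_, ?_, ?_, ?_,
    ?_, hmem g, ?_, ?_⟩
  · rw [← PowerSeries.coe_X]
    exact hmem _
  · rw [← zpow_neg_one, ht, Valuation.mem_valuationSubring_iff,
      LaurentSeries.val_le_one_iff_eq_coe]
    rintro ⟨h, hh⟩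
    have := congrArg (fun f : K⸨X⸩ => f.coeff (-1)) hh
    simp [PowerSeries.coeff_coe] at this
  · exact eulerOperator_single_one 1
  · intro c
    rw [LaurentSeries.algebraMap_apply, ← PowerSeries.coe_C]
    exact hmem _
  · intro g hg
    rw [Valuation.mem_valuationSubring_iff, LaurentSeries.val_le_one_iff_eq_coe] at hg
    obtain ⟨g, rfl⟩ := hg
    rw [← zpow_neg_one, ht, Valuation.mem_valuationSubring_iff]
    refine (LaurentSeries.valuation_le_iff_coeff_lt_eq_zero K (D := 0)).2 fun m hm => ?_
    rw [HahnSeries.coeff_single_mul, derivationOfLeibniz_apply, coeff_eulerOperator, one_mul]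
    -- The only possible pole comes from the constant term of `g`, which `t d/dt` multiplies by `0`.
    rcases eq_or_ne m (-1) with rfl | hm'
    · simp
    · rw [PowerSeries.coeff_coe, if_pos (by omega), mul_zero]
  · intro u hu
    obtain ⟨h, h1, hh⟩ := exists_aeval_single q hq0 u
    refine ⟨h, hmem h, ?_, ?_, ?_⟩
    · rw [Ne, map_eq_zero_iff _ HahnSeries.ofPowerSeries_injective]
      rintro rfl
      rw [map_zero] at h1
      exact hu (leadingCoeff_eq_zero.1 h1.symm)
    · rw [hunit h (by rw [h1]; simpa using hu)]
      exact hmem _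
    · rw [ht, ht, hh]
  · rw [hunit g (by simp [hg1])]
    exact hmem _
  · rw [ht, ht, hh, mul_pow, ← hg, HahnSeries.single_pow, PowerSeries.coe_pow]
    simp

end Laurent

/-! ### Basic relations in the function field. -/

section CurveBasics

variable (p q k : ℕ) [Fact p.Prime]

theorem toKz_injective (n : ℕ) : Function.Injective (toKz p n) :=
  (PerfectClosure.of (FractionRing (Fz p n)) p).injective.comp
    (IsFractionRing.injective (Fz p n) (FractionRing (Fz p n)))

theorem z_injective : Function.Injective (z p q k) :=
  fun _ _ h => MvPolynomial.X_injective (toKz_injective p _ h)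

theorem F_monic : (F p q k).Monic := monic_prod_of_monic _ _ fun _ _ => monic_X_sub_C _

theorem F_natDegree : (F p q k).natDegree = k * q + 1 := by
  rw [F, natDegree_prod_of_monic _ _ fun i _ => monic_X_sub_C _]
  simp

theorem F_separable : (F p q k).Separable :=
  separable_prod_X_sub_C_iff.2 (z_injective p q k)

theorem natCast_q_ne_zero [hq : Fact q.Prime] (hpq : p ≠ q) : (q : 𝕂 p q k) ≠ 0 := by
  rw [Ne, CharP.cast_eq_zero_iff (𝕂 p q k) p]
  exact fun h => hpq ((Nat.prime_dvd_prime_iff_eq (Fact.out : p.Prime) hq.out).1 h)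

variable [Fact q.Prime]

theorem aeval_x (u : (𝕂 p q k)[X]) :
    aeval (x p q k) u = AdjoinRoot.of (curvePoly p q k) (algebraMap _ _ u) := by
  have : x p q k = (IsScalarTower.toAlgHom (𝕂 p q k) (RatFunc (𝕂 p q k)) (FunField p q k))
      (algebraMap (𝕂 p q k)[X] _ X) := by
    rw [RatFunc.algebraMap_X]; rfl
  rw [this, aeval_algHom_apply, aeval_algebraMap_apply, aeval_X_left_apply]
  rfl

theorem y_pow_q : y p q k ^ q = aeval (x p q k) (F p q k) := by
  have := AdjoinRoot.eval₂_root (curvePoly p q k)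
  rw [curvePoly, eval₂_sub, eval₂_pow, eval₂_X, eval₂_C, sub_eq_zero] at this
  rw [aeval_x]
  exact this

theorem aeval_x_injective : Function.Injective (aeval (R := 𝕂 p q k) (x p q k)) := by
  intro u v h
  rw [aeval_x, aeval_x] at h
  exact RatFunc.algebraMap_injective _ ((AdjoinRoot.of (curvePoly p q k)).injective h)

theorem y_ne_zero : y p q k ≠ 0 := by
  intro h
  have := y_pow_q p q k
  rw [h, zero_pow (Fact.out : q.Prime).ne_zero] at this
  exact (F_monic p q k).ne_zero (aeval_x_injective p q k (by rw [← this, map_zero]))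

theorem x_ne_zero : x p q k ≠ 0 := by
  intro h
  exact X_ne_zero (aeval_x_injective p q k (by rw [aeval_X, h, map_zero]))

end CurveBasics

/-! ### Expansion of forms at infinity and the degree bound. -/

section AtInfinity

variable (p q k : ℕ) [Fact p.Prime] [Fact q.Prime]

/-- The expansion of functions and 1-forms on `X` in the local parameter `t` at infinity; a form
is written as a multiple of `dt / t`. -/
theorem exists_expansion_at_infinity (hpq : p ≠ q) :
    ∃ (L : Type) (_ : Field L) (ψ : FunField p q k →+* L) (lam : Forms p q k →+ L)
      (O : ValuationSubring L) (t : L), t ≠ 0 ∧ t ∈ O ∧ t⁻¹ ∉ O ∧ (q : L) ≠ 0 ∧ (q : L)⁻¹ ∈ O ∧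
        (∀ f, lam (f • dx p q k) = ψ f * (-q * t ^ (-q : ℤ))) ∧
        (∀ ω ∈ Omega p q k, t⁻¹ * lam ω ∈ O) ∧
        (∀ u : (𝕂 p q k)[X], u ≠ 0 → ∃ h ∈ O, h ≠ 0 ∧ h⁻¹ ∈ O ∧
          ψ (aeval (x p q k) u) = t ^ (-(q * u.natDegree) : ℤ) * h) ∧
        ∃ s ∈ O, s⁻¹ ∈ O ∧ ψ (y p q k) = t ^ (-(k * q + 1) : ℤ) * s := by
  obtain ⟨L, _, _, D, O, t, s, ht, htO, htO', hDt, hK, hD, hu, hs, hs', hy⟩ :=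
    exists_point_at_infinity (natCast_q_ne_zero p q k hpq) (F p q k) (F_monic p q k)
  -- Transcendence of `t⁻ᵠ`, which lets `x ↦ t⁻ᵠ` extend to rational functions.
  have hinj : Function.Injective (aeval (R := 𝕂 p q k) (t ^ (-q : ℤ))) := by
    rw [injective_iff_map_eq_zero]
    intro u h0
    by_contra hne
    obtain ⟨h, -, h', -, he⟩ := hu u hne
    rw [h0, zero_eq_mul, or_iff_right (zpow_ne_zero _ ht)] at he
    exact h' he
  let ψ₀ : RatFunc (𝕂 p q k) →ₐ[𝕂 p q k] L := IsFractionRing.liftAlgHom hinj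
  have hψ₀ : ∀ u : (𝕂 p q k)[X], ψ₀ (algebraMap _ _ u) = aeval (t ^ (-q : ℤ)) u := fun u =>
    IsFractionRing.lift_algebraMap hinj u
  let ψ : FunField p q k →+* L := AdjoinRoot.lift ψ₀.toRingHom (t ^ (-(k * q + 1) : ℤ) * s) (by
    rw [curvePoly, eval₂_sub, eval₂_pow, eval₂_X, eval₂_C, sub_eq_zero]
    refine Eq.trans ?_ (hψ₀ _).symm
    rw [← hy, F_natDegree]
    push_cast
    rfl)
  have hψu : ∀ u : (𝕂 p q k)[X], ψ (aeval (x p q k) u) = aeval (t ^ (-q : ℤ)) u := fun u => by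
    rw [aeval_x]
    exact (AdjoinRoot.lift_of _).trans (hψ₀ u)
  have hψK : ∀ c, ψ (algebraMap (𝕂 p q k) (FunField p q k) c) = algebraMap _ L c := fun c => by
    simpa using hψu (C c)
  have hψy : ψ (y p q k) = t ^ (-(k * q + 1) : ℤ) * s := AdjoinRoot.lift_root _
  have hψx : ψ (x p q k) = t ^ (-q : ℤ) := by simpa using hψu X
  let _ : Algebra (FunField p q k) L := ψ.toAlgebra
  have : IsScalarTower (𝕂 p q k) (FunField p q k) L :=
    IsScalarTower.of_algebraMap_eq fun c => (hψK c).symm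
  let lam := (D.compAlgebraMap (FunField p q k)).liftKaehlerDifferential
  have hlam : ∀ f g, lam (f • KaehlerDifferential.D (𝕂 p q k) (FunField p q k) g) =
      ψ f * D (ψ g) := fun f g => by
    rw [map_smul, Derivation.liftKaehlerDifferential_comp_D, Algebra.smul_def]
    rfl
  have hqK : algebraMap (𝕂 p q k) L (q : 𝕂 p q k)⁻¹ = (q : L)⁻¹ := by simp
  refine ⟨L, inferInstance, ψ, lam.toAddMonoidHom, O, t, ht, htO, htO', ?_, ?_, ?_, ?_, ?_,
    s, hs, hs', hψy⟩
  · have := (algebraMap (𝕂 p q k) L).injective.ne (natCast_q_ne_zero p q k hpq)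
    simpa using this
  · rw [← hqK]; exact hK _
  · intro f
    refine (hlam f _).trans ?_
    rw [hψx, Derivation.leibniz_zpow, hDt, smul_eq_mul, zpow_sub_one₀ ht,
      inv_mul_cancel_right₀ ht, zsmul_eq_mul]
    push_cast
    rfl
  · intro ω hω
    -- The pullback of the power series ring along `ψ` is the place at infinity.
    have hω' : ω ∈ regularAt p q k (O.comap ψ) := by
      simp only [Omega, Submodule.mem_iInf] at hω
      refine hω _ fun c => ?_
      rw [ValuationSubring.mem_comap, hψK]
      exact hK c
    refine Submodule.span_induction (p := fun ω _ => t⁻¹ * lam ω ∈ O) ?_ ?_ ?_ ?_ hω'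
    · rintro _ ⟨f, hf, g, hg, rfl⟩
      rw [hlam, mul_left_comm]
      exact mul_mem hf (hD _ hg)
    · simp
    · intro a b _ _ ha hb
      rw [map_add, mul_add]
      exact add_mem ha hb
    · intro c a _ ha
      rw [← algebraMap_smul (FunField p q k) c a, map_smul, Algebra.smul_def, mul_left_comm]
      refine mul_mem ?_ ha
      rw [← IsScalarTower.algebraMap_apply]
      exact hK c
  · intro u hu0
    rw [hψu]
    exact hu u hu0

/-- The expansion multiplies `ψ f` by `-q t⁻ᵠ`, which is nonzero because `p ≠ q`, and `ψ` is
injective. This reduces equalities of forms to equalities of functions. -/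
theorem smul_dx_eq_zero (hpq : p ≠ q) {f : FunField p q k} (h : f • dx p q k = 0) : f = 0 := by
  obtain ⟨L, _, ψ, lam, O, t, ht, -, -, hq, -, hlam, -⟩ := exists_expansion_at_infinity p q k hpq
  have := hlam f
  rw [h, map_zero, zero_eq_mul, or_iff_left] at this
  · exact (map_eq_zero ψ).1 this
  · exact mul_ne_zero (neg_ne_zero.2 hq) (zpow_ne_zero _ ht)

/-- A form `u(x) dx / y^a` regular at infinity has `deg u < ak`. -/
theorem natDegree_lt_of_mem_Omega (hpq : p ≠ q) {a : ℕ} (ha : a < q) {u : (𝕂 p q k)[X]}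
    (hu : u ≠ 0) (h : (aeval (x p q k) u / y p q k ^ a) • dx p q k ∈ Omega p q k) :
    u.natDegree < a * k := by
  obtain ⟨L, _, ψ, lam, O, t, ht, htO, htO', hq, hq', hlam, hO, hψ, s, hs, hs', hy⟩ :=
    exists_expansion_at_infinity p q k hpq
  obtain ⟨v, hv, hv0, hv', hvu⟩ := hψ u hu
  have hs0 : s ≠ 0 := by
    rintro rfl
    rw [mul_zero, map_eq_zero] at hy
    exact y_ne_zero p q k hy
  have h1 := hO _ h
  rw [hlam, map_div₀, map_pow, hvu, hy] at h1
  -- The order of the form at infinity as a multiple of `dt`. Regularity forces `e ≥ 0`, whereas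
  -- `deg u ≥ ak` would give `e ≤ a - q - 1 < 0`.
  set e : ℤ := a * (k * q + 1) - q * (u.natDegree + 1) - 1 with he
  have h2 : t ^ e ∈ O := by
    have h3 : t ^ e = (t⁻¹ * (t ^ (-(q * u.natDegree) : ℤ) * v / (t ^ (-(k * q + 1) : ℤ) * s) ^ a *
        (-q * t ^ (-q : ℤ)))) * (v⁻¹ * s ^ a * (-(q : L)⁻¹)) := by
      have : t ^ e = t⁻¹ * t ^ (-(q * u.natDegree) : ℤ) * ((t ^ (-(k * q + 1) : ℤ)) ^ a)⁻¹ *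
          t ^ (-q : ℤ) := by
        rw [← zpow_natCast, ← zpow_mul, ← zpow_neg, ← zpow_neg_one, ← zpow_add₀ ht, ← zpow_add₀ ht,
          ← zpow_add₀ ht]
        congr 1
        rw [he]
        ring
      rw [this, mul_pow]
      field_simp
    rw [h3]
    exact mul_mem h1 (mul_mem (mul_mem hv' (pow_mem hs a)) (neg_mem hq'))
  have h4 : 0 ≤ e := by
    by_contra hlt
    obtain ⟨m, hm⟩ := Int.exists_eq_neg_ofNat (show e + 1 ≤ 0 by omega)
    refine htO' ?_
    have : t⁻¹ = t ^ e * t ^ m := by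
      rw [← zpow_natCast, ← zpow_add₀ ht, ← zpow_neg_one]
      congr 1
      omega
    rw [this]
    exact mul_mem h2 (pow_mem htO m)
  by_contra hlt
  have h5 : (a : ℤ) * k ≤ u.natDegree := by exact_mod_cast not_lt.1 hlt
  have h6 : (a : ℤ) < q := by exact_mod_cast ha
  nlinarith

end AtInfinity

/-! ### Regularity of `x^i dx / y^a`. -/

section Regularity

variable {p q k : ℕ} [Fact p.Prime] [Fact q.Prime]

theorem D_aeval (f : FunField p q k) (u : (𝕂 p q k)[X]) :
    KaehlerDifferential.D (𝕂 p q k) (FunField p q k) (aeval f u) =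
      aeval f (derivative u) • KaehlerDifferential.D (𝕂 p q k) (FunField p q k) f :=
  Derivation.map_aeval _ _ _

theorem smul_D_mem_regularAt {O : ValuationSubring (FunField p q k)} {f g : FunField p q k}
    (hf : f ∈ O) (hg : g ∈ O) :
    f • KaehlerDifferential.D (𝕂 p q k) (FunField p q k) g ∈ regularAt p q k O :=
  Submodule.subset_span ⟨f, hf, g, hg, rfl⟩

theorem aeval_mem_valuationSubring {O : ValuationSubring (FunField p q k)}
    (hO : ∀ c : 𝕂 p q k, algebraMap (𝕂 p q k) (FunField p q k) c ∈ O) {f : FunField p q k}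
    (hf : f ∈ O) (u : (𝕂 p q k)[X]) : aeval f u ∈ O := by
  rw [aeval_eq_sum_range]
  refine sum_mem fun i _ => ?_
  rw [Algebra.smul_def]
  exact mul_mem (hO _) (pow_mem hf i)

theorem one_sub_inv_mem {L : Type*} [Field L] {O : ValuationSubring L} {m : L}
    (hm : O.valuation m < 1) : 1 - m ≠ 0 ∧ (1 - m)⁻¹ ∈ O := by
  have h : O.valuation (1 - m) = 1 := Valuation.map_one_sub_of_lt _ hm
  refine ⟨fun h0 => ?_, ?_⟩
  · rw [h0, map_zero] at h
    exact zero_ne_one h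
  · rw [← ValuationSubring.valuation_le_one_iff, map_inv₀, h, inv_one]

/-- With `uF + vF' = 1` and `q y^(q-1) dy = F' dx`, one has `dx/y^a = u y^(q-a) dx + q v y^(q-1-a)
dy`; all functions here are integral, as `a < q`. -/
theorem omegaForm_mem_regularAt_of_mem {O : ValuationSubring (FunField p q k)}
    (hO : ∀ c : 𝕂 p q k, algebraMap (𝕂 p q k) (FunField p q k) c ∈ O) (hx : x p q k ∈ O)
    {a : ℕ} (ha : a < q) (i : ℕ) : omegaForm p q k a i ∈ regularAt p q k O := by
  have hy : y p q k ∈ O := by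
    have := aeval_mem_valuationSubring hO hx (F p q k)
    rw [← y_pow_q, ← ValuationSubring.valuation_le_one_iff, map_pow] at this
    rw [← ValuationSubring.valuation_le_one_iff]
    exact (pow_le_one_iff (Fact.out : q.Prime).ne_zero).1 this
  obtain ⟨u, v, huv⟩ := F_separable p q k
  have hd : (q * y p q k ^ (q - 1)) • KaehlerDifferential.D (𝕂 p q k) (FunField p q k) (y p q k) =
      aeval (x p q k) (derivative (F p q k)) • dx p q k := by
    have := D_aeval (x p q k) (F p q k)
    rw [← y_pow_q, Derivation.leibniz_pow, ← Nat.cast_smul_eq_nsmul (FunField p q k), smul_smul]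
      at this
    exact this
  have huv' : aeval (x p q k) u * y p q k ^ q +
      aeval (x p q k) v * aeval (x p q k) (derivative (F p q k)) = 1 := by
    rw [y_pow_q, ← map_mul, ← map_mul, ← map_add, huv, map_one]
  have hq1 : y p q k ^ q = y p q k ^ (q - a) * y p q k ^ a := by
    rw [← pow_add, Nat.sub_add_cancel ha.le]
  have hq2 : y p q k ^ (q - 1) = y p q k ^ (q - 1 - a) * y p q k ^ a := by
    rw [← pow_add, Nat.sub_add_cancel (by omega)]
  have h0 := y_ne_zero p q k
  have key : omegaForm p q k a i =
      (x p q k ^ i * aeval (x p q k) u * y p q k ^ (q - a)) • dx p q k +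
      (x p q k ^ i * aeval (x p q k) v * q * y p q k ^ (q - 1 - a)) •
        KaehlerDifferential.D (𝕂 p q k) (FunField p q k) (y p q k) := by
    have h1 : (x p q k ^ i * aeval (x p q k) v * q * y p q k ^ (q - 1 - a)) •
        KaehlerDifferential.D (𝕂 p q k) (FunField p q k) (y p q k) =
        (x p q k ^ i * aeval (x p q k) v / y p q k ^ a *
          aeval (x p q k) (derivative (F p q k))) • dx p q k := by
      rw [mul_smul _ _ (dx p q k), ← hd, smul_smul, hq2]
      congr 1
      field_simp
    rw [h1, ← add_smul, omegaForm]
    congr 1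
    rw [hq1] at huv'
    field_simp
    linear_combination (-x p q k ^ i) * huv'
  have hmem := fun w => aeval_mem_valuationSubring hO hx w
  rw [key]
  exact add_mem
    (smul_D_mem_regularAt (mul_mem (mul_mem (pow_mem hx i) (hmem u)) (pow_mem hy _)) hx)
    (smul_D_mem_regularAt (mul_mem (mul_mem (mul_mem (pow_mem hx i) (hmem v)) (natCast_mem O q))
      (pow_mem hy _)) hy)

/-- Put `s = 1/x` and `t = x^k/y`. Then `s = t^q G(s)` for the reversed polynomial `G` of `F`, and
`G(s)` is a unit since `G(0) = 1`. Differentiating expresses `ds`, hence the form, through `dt` with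
an integral coefficient. -/
theorem omegaForm_mem_regularAt_of_notMem {O : ValuationSubring (FunField p q k)}
    (hO : ∀ c : 𝕂 p q k, algebraMap (𝕂 p q k) (FunField p q k) c ∈ O) (hx : x p q k ∉ O)
    {a : ℕ} (ha : 1 ≤ a) {i : ℕ} (hi : i < a * k) : omegaForm p q k a i ∈ regularAt p q k O := by
  have hx0 := x_ne_zero p q k
  have hy0 := y_ne_zero p q k
  have hqpos := (Fact.out : q.Prime).pos
  obtain ⟨s, hs⟩ : ∃ s, s = (x p q k)⁻¹ := ⟨_, rfl⟩
  have hxs : x p q k * s = 1 := by rw [hs, mul_inv_cancel₀ hx0]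
  have hvs : O.valuation s < 1 := by
    rw [← ValuationSubring.valuation_le_one_iff, not_le] at hx
    rw [hs, map_inv₀]
    exact inv_lt_one_of_one_lt₀ hx
  have hsO : s ∈ O := (ValuationSubring.valuation_le_one_iff _ _).1 hvs.le
  set G := (F p q k).reverse with hG
  obtain ⟨H, hH⟩ : ∃ H, G = 1 + X * H := by
    obtain ⟨H, hH⟩ := (X_dvd_iff (f := G - 1)).2 (by
      rw [coeff_sub, hG, coeff_zero_reverse, (F_monic p q k).leadingCoeff, coeff_one_zero,
        sub_self])
    exact ⟨H, by rw [← hH]; ring⟩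
  have hGO : (aeval s G) ∈ O := aeval_mem_valuationSubring hO hsO G
  obtain ⟨hG0, hGinv⟩ : aeval s G ≠ 0 ∧ (aeval s G)⁻¹ ∈ O := by
    have := one_sub_inv_mem (O := O) (m := -(s * aeval s H)) (by
      rw [Valuation.map_neg, map_mul]
      exact mul_lt_one_of_lt_of_le hvs ((ValuationSubring.valuation_le_one_iff _ _).2
        (aeval_mem_valuationSubring hO hsO H)))
    rw [hH, map_add, map_mul, map_one, aeval_X, ← sub_neg_eq_add]
    exact this
  have hFG : aeval (x p q k) (F p q k) = aeval s G * x p q k ^ (k * q + 1) := by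
    let _ : Invertible (x p q k) := ⟨s, by rw [mul_comm, hxs], hxs⟩
    have := eval₂_reverse_mul_pow (algebraMap (𝕂 p q k) (FunField p q k)) (x p q k) (F p q k)
    rw [F_natDegree] at this
    exact this.symm
  obtain ⟨t, ht⟩ : ∃ t, t = x p q k ^ k / y p q k := ⟨_, rfl⟩
  have ht0 : t ≠ 0 := by rw [ht]; positivity
  have hty : t * y p q k = x p q k ^ k := by rw [ht, div_mul_cancel₀ _ hy0]
  have htG : t ^ q * aeval s G = s := by
    have h1 : t ^ q * y p q k ^ q = x p q k ^ (k * q) := by rw [← mul_pow, hty, pow_mul]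
    rw [y_pow_q, hFG] at h1
    have h2 : x p q k ^ (k * q + 1) ≠ 0 := pow_ne_zero _ hx0
    refine mul_right_cancel₀ h2 ?_
    rw [mul_assoc, h1, pow_succ]
    linear_combination (-x p q k ^ (k * q)) * hxs
  have hvt : O.valuation (t ^ q) < 1 := by
    rw [← mul_inv_cancel_right₀ hG0 (t ^ q), htG, map_mul]
    exact mul_lt_one_of_lt_of_le hvs ((ValuationSubring.valuation_le_one_iff _ _).2 hGinv)
  have htO : t ∈ O := by
    rw [← ValuationSubring.valuation_le_one_iff]
    rw [map_pow] at hvt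
    exact (pow_le_one_iff hqpos.ne').1 hvt.le
  obtain ⟨hw0, hw⟩ := one_sub_inv_mem (O := O) (m := t ^ q * aeval s (derivative G)) (by
    rw [map_mul]
    exact mul_lt_one_of_lt_of_le hvt ((ValuationSubring.valuation_le_one_iff _ _).2
      (aeval_mem_valuationSubring hO hsO _)))
  -- The factor of `ds` after collecting terms in the differential of `t^q G(s) = s`.
  set w := 1 - t ^ q * aeval s (derivative G) with hwdef
  have hDs : w • KaehlerDifferential.D (𝕂 p q k) (FunField p q k) s =
      (aeval s G * (q * t ^ (q - 1))) • KaehlerDifferential.D (𝕂 p q k) (FunField p q k) t := by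
    have h1 := congrArg (KaehlerDifferential.D (𝕂 p q k) (FunField p q k)) htG
    rw [Derivation.leibniz, D_aeval, Derivation.leibniz_pow,
      ← Nat.cast_smul_eq_nsmul (FunField p q k), smul_smul, smul_smul, smul_smul] at h1
    rw [hwdef, sub_smul, one_smul, sub_eq_iff_eq_add', ← mul_assoc]
    exact h1.symm
  have hdx : dx p q k = (-x p q k ^ 2) • KaehlerDifferential.D (𝕂 p q k) (FunField p q k) s := by
    rw [hs, Derivation.leibniz_inv, smul_smul, dx]
    nth_rw 1 [← one_smul (FunField p q k) (KaehlerDifferential.D _ _ (x p q k))]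
    congr 1
    field_simp
  have key : omegaForm p q k a i =
      (-(s ^ (a * k - 1 - i) * t ^ (a - 1) * q * w⁻¹)) •
        KaehlerDifferential.D (𝕂 p q k) (FunField p q k) t := by
    have h1 : KaehlerDifferential.D (𝕂 p q k) (FunField p q k) s =
        (w⁻¹ * (aeval s G * (q * t ^ (q - 1)))) •
          KaehlerDifferential.D (𝕂 p q k) (FunField p q k) t := by
      rw [mul_smul, ← hDs, smul_smul, inv_mul_cancel₀ hw0, one_smul]
    rw [omegaForm, hdx, h1, smul_smul, smul_smul]
    congr 1
    -- Substitute `t^q G(s) = s = 1/x` and `y^a = x^(ak)/t^a`; the exponent `ak - 1 - i` is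
    -- nonnegative because `i < ak`.
    have h2 : x p q k ^ i / y p q k ^ a * x p q k ^ 2 * (aeval s G * t ^ (q - 1)) =
        s ^ (a * k - 1 - i) * t ^ (a - 1) := by
      obtain ⟨e, he⟩ : ∃ e, a * k = i + 1 + e := ⟨a * k - (i + 1), by omega⟩
      have h3 : t ^ (q - 1) * t = t ^ q := pow_sub_one_mul hqpos.ne' t
      have h4 : t ^ (a - 1) * t = t ^ a := pow_sub_one_mul (by omega) t
      have h5 : t ^ a * y p q k ^ a = x p q k ^ (i + 1 + e) := by
        rw [← mul_pow, hty, ← pow_mul, mul_comm k a, he]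
      have h6 : s ^ e * x p q k ^ e = 1 := by rw [← mul_pow, mul_comm s, hxs, one_pow]
      rw [show a * k - 1 - i = e by omega]
      have h7 : y p q k ^ a ≠ 0 := pow_ne_zero _ hy0
      refine mul_right_cancel₀ (mul_ne_zero ht0 h7) ?_
      calc _ = x p q k ^ i * x p q k ^ 2 * (aeval s G * (t ^ (q - 1) * t)) := by
            field_simp
        _ = x p q k ^ (i + 1) * (x p q k * s) := by rw [h3, mul_comm (aeval s G), htG]; ring
        _ = (s ^ e * x p q k ^ e) * x p q k ^ (i + 1) := by rw [hxs, h6]; ring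
        _ = s ^ e * (t ^ a * y p q k ^ a) := by rw [h5]; ring
        _ = _ := by rw [← h4]; ring
    linear_combination (-(q * w⁻¹)) * h2
  rw [key]
  exact smul_D_mem_regularAt (neg_mem (mul_mem (mul_mem (mul_mem (pow_mem hsO _) (pow_mem htO _))
    (natCast_mem O q)) hw)) htO

theorem omegaForm_mem_Omega {a : ℕ} (ha : 1 ≤ a) (haq : a < q) {i : ℕ} (hi : i < a * k) :
    omegaForm p q k a i ∈ Omega p q k := by
  simp only [Omega, Submodule.mem_iInf]
  intro O hO
  by_cases hx : x p q k ∈ O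
  · exact omegaForm_mem_regularAt_of_mem hO hx haq i
  · exact omegaForm_mem_regularAt_of_notMem hO hx ha hi

end Regularity

/-! ### The bases of `Ω¹_a(X)` and `W(X)`. -/

section Bases

variable (p q k : ℕ) [Fact p.Prime] [Fact q.Prime]

theorem omegaForm_eq (a i : ℕ) :
    omegaForm p q k a i = (aeval (x p q k) (X ^ i : (𝕂 p q k)[X]) / y p q k ^ a) • dx p q k := by
  rw [map_pow, aeval_X, omegaForm]

theorem sum_smul_omegaForm {ι : Type*} (s : Finset ι) (a : ℕ) (c : ι → 𝕂 p q k) (e : ι → ℕ) :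
    ∑ m ∈ s, c m • omegaForm p q k a (e m) =
      (aeval (x p q k) (∑ m ∈ s, C (c m) * X ^ e m) / y p q k ^ a) • dx p q k := by
  rw [map_sum, Finset.sum_div, Finset.sum_smul]
  refine Finset.sum_congr rfl fun m _ => ?_
  rw [omegaForm_eq, ← smul_eq_C_mul, map_smul, smul_div_assoc, smul_assoc]

theorem smul_dx_injective (hpq : p ≠ q) (a : ℕ) {u v : (𝕂 p q k)[X]}
    (h : (aeval (x p q k) u / y p q k ^ a) • dx p q k =
      (aeval (x p q k) v / y p q k ^ a) • dx p q k) : u = v := by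
  rw [← sub_eq_zero, ← sub_smul, ← sub_div] at h
  have := smul_dx_eq_zero p q k hpq h
  rw [div_eq_zero_iff, or_iff_left (pow_ne_zero _ (y_ne_zero p q k)), sub_eq_zero] at this
  exact aeval_x_injective p q k this

/-- Regularity puts the listed forms in the space, and the degree bound at infinity shows that they
exhaust it. -/
theorem exists_basis_OmegaEig (hpq : p ≠ q) {a : ℕ} (ha : 1 ≤ a) (haq : a < q) :
    ∃ b : Module.Basis (Fin (a * k)) (𝕂 p q k) (OmegaEig p q k a),
      ∀ m, (b m : Forms p q k) = omegaForm p q k a (a * k - (m + 1)) := by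
  let v : Fin (a * k) → OmegaEig p q k a := fun m =>
    ⟨omegaForm p q k a (a * k - (m + 1)), omegaForm_mem_Omega ha haq (by omega),
      X ^ (a * k - (m + 1) : ℕ), omegaForm_eq p q k _ _⟩
  have hli : LinearIndependent (𝕂 p q k) v := by
    rw [Fintype.linearIndependent_iff]
    intro c hc m
    have h1 := congrArg (Subtype.val) hc
    have h2 : ∑ m, c m • omegaForm p q k a (a * k - (m + 1)) = 0 := by
      simpa [v] using h1
    rw [sum_smul_omegaForm p q k Finset.univ a c fun m => a * k - (m + 1)] at h2
    have h3 := smul_dx_injective p q k hpq a (v := 0) (h2.trans (by simp))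
    have h4 := congrArg (coeff · (a * k - (m + 1))) h3
    simp only [finsetSum_coeff, coeff_C_mul, coeff_X_pow, coeff_zero] at h4
    rw [Finset.sum_eq_single m] at h4
    · simpa using h4
    · intro j _ hj
      rw [if_neg, mul_zero]
      intro h
      exact hj (Fin.ext (by omega))
    · simp
  refine ⟨Module.Basis.mk hli ?_, fun m => by rw [Module.Basis.mk_apply]⟩
  rintro ⟨ω, hω, u, rfl⟩ -
  have hdeg : u = 0 ∨ u.natDegree < a * k := by
    by_cases hu : u = 0
    · exact Or.inl hu
    · exact Or.inr (natDegree_lt_of_mem_Omega p q k hpq haq hu hω)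
  rcases hdeg with rfl | hdeg
  · convert Submodule.zero_mem _ using 1
    ext
    simp
  have : (⟨_, hω, u, rfl⟩ : OmegaEig p q k a) =
      ∑ m : Fin (a * k), u.coeff (a * k - (m + 1)) • v m := by
    ext
    have h1 : ((∑ m : Fin (a * k), u.coeff (a * k - (m + 1)) • v m : OmegaEig p q k a) :
        Forms p q k) = ∑ m : Fin (a * k), u.coeff (a * k - (m + 1)) •
          omegaForm p q k a (a * k - (m + 1)) := by
      simp [v]
    refine Eq.trans ?_ (h1.trans (sum_smul_omegaForm p q k Finset.univ a
      (fun m : Fin (a * k) => u.coeff (a * k - (m + 1))) fun m => a * k - (m + 1))).symm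
    have hu : u = ∑ m : Fin (a * k), C (u.coeff (a * k - (m + 1))) * X ^ (a * k - (m + 1) : ℕ) := by
      -- The basis lists exponents in decreasing order, from `ak - 1` to `0`, so the coefficient sum
      -- is reflected.
      conv_lhs => rw [u.as_sum_range_C_mul_X_pow' hdeg, ← Finset.sum_range_reflect,
        Finset.sum_range]
      refine Finset.sum_congr rfl fun m _ => ?_
      rw [Nat.sub_sub, add_comm 1]
    exact congrArg (fun v => (aeval (x p q k) v / y p q k ^ a) • dx p q k) hu
  rw [this]
  exact Submodule.sum_mem _ fun m _ => Submodule.smul_mem _ _ (Submodule.subset_span ⟨m, rfl⟩)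

/-- Clearing denominators by `F y` turns a relation into one between the products `∏_{l ≠ i} (x -
z_l)`; at `x = z_j` only the `j`-th survives, as the `z_l` are distinct. -/
theorem wForm_linearIndependent (hpq : p ≠ q) : LinearIndependent (𝕂 p q k) (wForm p q k) := by
  have hxz : ∀ j, x p q k - algebraMap (𝕂 p q k) (FunField p q k) (z p q k j) =
      aeval (x p q k) (X - C (z p q k j)) := fun j => by simp
  have hxz0 : ∀ j, x p q k - algebraMap (𝕂 p q k) (FunField p q k) (z p q k j) ≠ 0 := fun j h => by
    rw [hxz] at h
    exact X_sub_C_ne_zero _ (aeval_x_injective p q k (by rw [h, map_zero]))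
  rw [Fintype.linearIndependent_iff]
  intro c hc j
  have h1 : (∑ i, c i • ((x p q k - algebraMap (𝕂 p q k) (FunField p q k) (z p q k i))⁻¹
      / y p q k)) • dx p q k = 0 := by
    rw [← hc, Finset.sum_smul]
    exact Finset.sum_congr rfl fun i _ => by rw [smul_assoc, wForm]
  have h2 := smul_dx_eq_zero p q k hpq h1
  have h3 : aeval (x p q k) (∑ i, C (c i) * ∏ l ∈ Finset.univ.erase i, (X - C (z p q k l))) = 0 := by
    rw [← mul_zero (aeval (x p q k) (F p q k) * y p q k), ← h2, map_sum, Finset.mul_sum]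
    refine Finset.sum_congr rfl fun i _ => ?_
    rw [F, ← Finset.mul_prod_erase _ _ (Finset.mem_univ i), map_mul, map_mul, ← hxz, aeval_C,
      Algebra.smul_def]
    have := hxz0 i
    have := y_ne_zero p q k
    field_simp
  have h4 := aeval_x_injective p q k (h3.trans (map_zero _).symm)
  have h5 := congrArg (eval (z p q k j)) h4
  rw [eval_finsetSum, Finset.sum_eq_single j, eval_mul, eval_C, eval_zero, mul_eq_zero] at h5
  · refine h5.resolve_right ?_
    rw [eval_prod, ← Ne, Finset.prod_ne_zero_iff]
    intro l hl
    rw [eval_sub, eval_X, eval_C, sub_ne_zero]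
    exact (z_injective p q k).ne (Finset.ne_of_mem_erase hl).symm
  · intro i _ hi
    rw [eval_mul, eval_prod, Finset.prod_eq_zero (Finset.mem_erase.2 ⟨hi.symm, Finset.mem_univ j⟩),
      mul_zero]
    simp
  · simp

theorem exists_basis_W (hpq : p ≠ q) :
    ∃ w : Module.Basis (Fin (k * q + 1)) (𝕂 p q k) (W p q k),
      ∀ j, (w j : Forms p q k) = wForm p q k j :=
  ⟨Module.Basis.span (wForm_linearIndependent p q k hpq), fun j =>
    congrArg Subtype.val (Module.Basis.span_apply (wForm_linearIndependent p q k hpq) j)⟩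

end Bases

/-! ### Polynomials with zero derivative and the gap argument. -/

section Semisimple

variable {K : Type*} [Field K]

/-- If `F A' = r F' A` with `F` separable and `1, …, r` invertible, then `F ^ r` divides `A`. -/
theorem pow_dvd_of_mul_derivative_eq {f : K[X]} (hf : f.Separable) (hf0 : f ≠ 0) (r : ℕ)
    (hr : ∀ i, 1 ≤ i → i ≤ r → (i : K) ≠ 0) (A : K[X])
    (h : f * derivative A = (r : K[X]) * derivative f * A) : f ^ r ∣ A := by
  induction r generalizing A with
  | zero => simp
  | succ r ih =>
    have hu : IsUnit ((r + 1 : ℕ) : K[X]) := by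
      have := (Ne.isUnit (hr (r + 1) (by omega) le_rfl)).map (C : K →+* K[X])
      rwa [map_natCast] at this
    have h1 : f ∣ derivative f * A := by
      have : f ∣ ((r + 1 : ℕ) : K[X]) * (derivative f * A) := ⟨derivative A, by rw [h]; ring⟩
      exact (hu.dvd_mul_left).1 this
    -- Since `f` is prime to `f'`, it divides `A`; the quotient satisfies the same equation with `r`
    -- in place of `r + 1`.
    obtain ⟨A', rfl⟩ := hf.dvd_of_dvd_mul_left h1
    have h2 : f * derivative A' = (r : K[X]) * derivative f * A' := by
      refine mul_left_cancel₀ hf0 ?_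
      rw [derivative_mul] at h
      push_cast at h
      linear_combination h
    rw [pow_succ']
    exact mul_dvd_mul_left f (ih (fun i h1 h2 => hr i h1 (by omega)) A' h2)

/-- A polynomial `c` with zero derivative vanishes as soon as `n` consecutive coefficients
of `f ^ (M - 1) * c` below `x ^ s` vanish, where `n` is the degree of `f`. -/
theorem eq_zero_of_coeff_pow_mul_eq_zero {f : K[X]} (hfm : f.Monic) (hf : f.Separable) {M s : ℕ}
    (hM : ∀ i, 1 ≤ i → i ≤ M → (i : K) ≠ 0) (hs : f.natDegree ≤ s)
    (hsM : s ≤ f.natDegree * (M + 1)) (hsK : (s : K) = 0) {c : K[X]} (hc : derivative c = 0)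
    (hcs : c.natDegree < s)
    (h : ∀ i, s - f.natDegree ≤ i → i < s → (f ^ M * c).coeff i = 0) : c = 0 := by
  have hf0 := hfm.ne_zero
  obtain ⟨P, hP⟩ : ∃ P, P = f ^ M * c := ⟨_, rfl⟩
  rw [← hP] at h
  obtain ⟨A, B, hAB, hB⟩ : ∃ A B : K[X], P = X ^ s * A + B ∧ B.degree < s := by
    refine ⟨P /ₘ X ^ s, P %ₘ X ^ s, ?_, ?_⟩
    · rw [add_comm, modByMonic_add_div]
    · exact (degree_modByMonic_lt _ (monic_X_pow s)).trans_le (degree_X_pow_le s)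
  -- The vanishing window leaves room for multiplication by `f`: neither `f B` nor `f' B` reaches
  -- degree `s`.
  have hBlt : B.degree < ((s - f.natDegree : ℕ) : WithBot ℕ) := by
    rw [degree_lt_iff_coeff_zero] at hB ⊢
    intro i hi
    rcases lt_or_ge i s with his | his
    · have := h i hi his
      rwa [hAB, coeff_add, coeff_X_pow_mul', if_neg (by omega), zero_add] at this
    · exact hB i his
  have hmul : ∀ g : K[X], g.natDegree ≤ f.natDegree → (g * B).degree < s := by
    intro g hg
    rcases eq_or_ne B 0 with rfl | hB0
    · simp
    · refine (degree_mul_le g B).trans_lt ?_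
      rw [degree_eq_natDegree hB0] at hBlt ⊢
      have h1 : B.natDegree < s - f.natDegree := by exact_mod_cast hBlt
      calc g.degree + (B.natDegree : WithBot ℕ)
          ≤ (f.natDegree : WithBot ℕ) + (B.natDegree : WithBot ℕ) := by
            gcongr
            exact degree_le_of_natDegree_le hg
        _ < s := by
            rw [← Nat.cast_add, Nat.cast_lt]
            omega
  have hdP : derivative (f * P) = ((M + 1 : ℕ) : K[X]) * derivative f * P := by
    rw [hP, ← mul_assoc, ← pow_succ', derivative_mul, hc, mul_zero, add_zero, derivative_pow_succ]
    simp
    ring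
  have hXs : derivative (X ^ s : K[X]) = 0 := by
    rw [derivative_X_pow, hsK]
    simp
  -- The equation `(f P)' = (M + 1) f' P` separates along `X^s`, which has zero derivative. The left
  -- side is a multiple of `X^s` and the right has degree below `s`, so both vanish.
  have hsplit : X ^ s * (derivative (f * A) - ((M + 1 : ℕ) : K[X]) * derivative f * A) =
      ((M + 1 : ℕ) : K[X]) * (derivative f * B) - derivative (f * B) := by
    rw [hAB, mul_add, mul_left_comm, derivative_add, derivative_mul, hXs] at hdP
    linear_combination hdP
  have hA : derivative (f * A) - ((M + 1 : ℕ) : K[X]) * derivative f * A = 0 := by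
    by_contra hne
    have hlt : (X ^ s * (derivative (f * A) - ((M + 1 : ℕ) : K[X]) * derivative f * A)).degree
        < (s : WithBot ℕ) := by
      rw [hsplit]
      refine (degree_sub_le _ _).trans_lt (max_lt ?_ ?_)
      · rw [← nsmul_eq_mul]
        exact (degree_smul_le _ _).trans_lt
          (hmul _ ((natDegree_derivative_le f).trans (Nat.sub_le _ _)))
      · exact degree_derivative_le.trans_lt (hmul f le_rfl)
    rw [degree_mul, degree_X_pow, degree_eq_natDegree hne, ← Nat.cast_add, Nat.cast_lt] at hlt
    omega
  -- A nonzero `A` would be a multiple of `f^M`, giving `deg P ≥ s + M deg f`, against `deg c < s`.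
  have hA0 : A = 0 := by
    by_contra hne
    have hdvd := pow_dvd_of_mul_derivative_eq hf hf0 M hM A (by
      rw [derivative_mul] at hA
      push_cast at hA
      linear_combination hA)
    have h1 := natDegree_le_of_dvd hdvd hne
    rw [natDegree_pow] at h1
    have h2 : s + A.natDegree ≤ P.natDegree := by
      refine le_natDegree_of_ne_zero ?_
      rw [hAB, coeff_add, add_comm s, coeff_X_pow_mul,
        coeff_eq_zero_of_degree_lt (hB.trans_le (by exact_mod_cast Nat.le_add_left _ _)), add_zero]
      exact leadingCoeff_ne_zero.2 hne
    have h3 : P.natDegree ≤ M * f.natDegree + c.natDegree := by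
      rw [hP]
      refine natDegree_mul_le.trans ?_
      rw [natDegree_pow]
    omega
  by_contra hc0
  rw [hA0, mul_zero, zero_add] at hAB
  have hP0 : P ≠ 0 := by rw [hP]; exact mul_ne_zero (pow_ne_zero _ hf0) hc0
  rw [← hAB, degree_eq_natDegree hP0, Nat.cast_lt, hP, natDegree_mul (pow_ne_zero _ hf0) hc0,
    natDegree_pow] at hBlt
  have : f.natDegree * (M + 1) = M * f.natDegree + f.natDegree := by ring
  omega

/-- The polynomials `∏_{i ≠ j} (x - z_i)` span the polynomials of degree less than `n`. -/
theorem exists_eq_sum_prod_erase {n : ℕ} {z : Fin n → K} (hz : Function.Injective z) {u : K[X]}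
    (hu : u.degree < n) :
    ∃ d : Fin n → K, u = ∑ j, C (d j) * ∏ i ∈ Finset.univ.erase j, (X - C (z i)) := by
  have hne : ∀ j, eval (z j) (∏ i ∈ Finset.univ.erase j, (X - C (z i))) ≠ 0 := by
    intro j
    rw [eval_prod, Finset.prod_ne_zero_iff]
    intro l hl
    rw [eval_sub, eval_X, eval_C, sub_ne_zero]
    exact hz.ne (Finset.ne_of_mem_erase hl).symm
  -- Lagrange interpolation at the nodes `z_j`.
  refine ⟨fun j => eval (z j) u / eval (z j) (∏ i ∈ Finset.univ.erase j, (X - C (z i))), ?_⟩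
  refine eq_of_degrees_lt_of_eval_index_eq Finset.univ (fun i _ j _ h => hz h) (by simpa using hu)
    ?_ fun j _ => ?_
  · rw [Finset.card_univ, Fintype.card_fin]
    refine (degree_sum_le _ _).trans_lt ((Finset.sup_lt_iff (WithBot.bot_lt_coe n)).2 fun j _ => ?_)
    rw [← smul_eq_C_mul]
    refine (degree_smul_le _ _).trans_lt ?_
    rw [degree_prod_of_monic _ _ fun i _ => monic_X_sub_C _]
    simp only [degree_X_sub_C, Finset.sum_const, Finset.card_erase_of_mem (Finset.mem_univ j),
      Finset.card_univ, Fintype.card_fin, nsmul_eq_mul, mul_one]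
    have := j.2
    exact Nat.cast_lt.2 (show n - 1 < n by omega)
  · rw [eval_finsetSum, Finset.sum_eq_single j]
    · rw [eval_mul, eval_C, div_mul_cancel₀ _ (hne j)]
    · intro i _ hi
      rw [eval_mul, eval_prod, Finset.prod_eq_zero
        (Finset.mem_erase.2 ⟨hi.symm, Finset.mem_univ j⟩), mul_zero]
      simp
    · simp

end Semisimple

/-! ### The subring `𝔽_p[z^p]` and Frobenius. -/

section FrobeniusSubring

variable (p n : ℕ) [Fact p.Prime]

/-- Substituting `z_i^p` for `z_i` is the Frobenius of `𝔽_p[z]`, because it fixes the coefficients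
in `𝔽_p`. -/
theorem mem_Fzp_iff (f : Fz p n) : f ∈ Fzp p n ↔ ∃ g : Fz p n, f = g ^ p := by
  have h : Fzp p n = (MvPolynomial.expand (σ := Fin n) (R := ZMod p) p).range := by
    rw [Fzp, ← Algebra.map_top, ← MvPolynomial.adjoin_range_X, AlgHom.map_adjoin, ← Set.range_comp]
    congr 2
    ext i
    simp
  rw [h, AlgHom.mem_range]
  constructor
  · rintro ⟨g, rfl⟩
    exact ⟨g, MvPolynomial.expand_zmod g⟩
  · rintro ⟨g, rfl⟩
    exact ⟨g, MvPolynomial.expand_zmod g⟩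

theorem σ_apply (f : Kz p n) : σ p n f = f ^ p := rfl

theorem σ_τ (f : Kz p n) : σ p n (τ p n f) = f := (frobeniusEquiv (Kz p n) p).apply_symm_apply f

theorem σ_toKz (f : Fz p n) : σ p n (toKz p n f) = toKz p n (f ^ p) := by
  rw [σ_apply, map_pow]

end FrobeniusSubring

/-! ### Independence and generation for the vectors `I^m(z)`. -/

section SolutionVectors

variable {p q k a₁ : ℕ} [Fact p.Prime]

/-- Modulo `p` the relation reads `qM = -1`, and `a₁ < q` gives `M < p`, so `M` is the least
positive member of its class. -/
theorem Mbar_eq [Fact q.Prime] (hpq : p ≠ q) (ha_lt : a₁ < q) {M : ℕ} (hM0 : 0 < M) (hM : q * M + 1 = a₁ * p)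
    {n : ℕ} : Mbar (n := n) p q (fun _ => 1) = fun _ => M := by
  have hq0 : (q : ZMod p) ≠ 0 := by
    rw [Ne, ZMod.natCast_eq_zero_iff]
    exact fun h => hpq ((Nat.prime_dvd_prime_iff_eq Fact.out Fact.out).1 h)
  have hMp : M < p := by
    by_contra hle
    have h1 : q * p ≤ q * M := Nat.mul_le_mul_left q (not_lt.1 hle)
    have h2 : a₁ * p < q * p := Nat.mul_lt_mul_of_pos_right ha_lt (Fact.out : p.Prime).pos
    omega
  have hMem : (M : ZMod p) = -1 / (q : ZMod p) := by
    rw [eq_div_iff hq0, eq_neg_iff_add_eq_zero]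
    have := congrArg (Nat.cast : ℕ → ZMod p) hM
    push_cast at this
    rw [CharP.cast_eq_zero (ZMod p) p, mul_zero] at this
    rw [mul_comm, this]
  funext i
  refine IsLeast.csInf_eq ⟨⟨hM0, by simpa using hMem⟩, ?_⟩
  rintro m ⟨-, hm⟩
  by_contra hlt
  have h1 : (m : ZMod p) = (M : ZMod p) := by rw [hMem, hm]; simp
  rw [ZMod.natCast_eq_natCast_iff', Nat.mod_eq_of_lt hMp, Nat.mod_eq_of_lt (by omega)] at h1
  omega

-- Isolates the common factor `F^(M-1)`, leaving the interpolation products, which span all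
-- polynomials of degree less than `n`.
variable (p q k) in
theorem map_Pcoord {M : ℕ} (hM : 0 < M) (j : Fin (k * q + 1)) :
    (Pcoord p (fun _ => M) j).map (toKz p (k * q + 1)) =
      F p q k ^ (M - 1) * ∏ i ∈ Finset.univ.erase j, (X - C (z p q k i)) := by
  rw [F, ← Finset.mul_prod_erase _ _ (Finset.mem_univ j), Pcoord]
  simp only [Polynomial.map_mul, Polynomial.map_pow, Polynomial.map_prod, Polynomial.map_sub,
    map_X, map_C, Finset.prod_pow]
  rw [mul_pow, mul_assoc, ← pow_succ, Nat.sub_add_cancel hM]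
  rfl

theorem natDegree_Pcoord_le {n M : ℕ} (hM : 0 < M) (j : Fin n) :
    (Pcoord p (fun _ => M) j).natDegree ≤ n * M - 1 := by
  have h1 : ((X - C (MvPolynomial.X j : Fz p n)) * Pcoord p (fun _ => M) j) =
      ∏ i : Fin n, (X - C (MvPolynomial.X i : Fz p n)) ^ M := by
    rw [Pcoord, ← mul_assoc, ← pow_succ', Nat.sub_add_cancel hM,
      Finset.mul_prod_erase _ (fun i => (X - C (MvPolynomial.X i : Fz p n)) ^ M)
        (Finset.mem_univ j)]
  have h2 := congrArg natDegree h1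
  rw [(monic_X_sub_C _).natDegree_mul', natDegree_X_sub_C,
    natDegree_prod_of_monic _ _ fun i _ => (monic_X_sub_C _).pow M] at h2
  · simp only [natDegree_pow, natDegree_X_sub_C, mul_one, Finset.sum_const, Finset.card_univ,
      Fintype.card_fin, smul_eq_mul] at h2
    omega
  · rintro h0
    rw [h0, mul_zero] at h1
    exact (monic_prod_of_monic _ _ fun i _ => (monic_X_sub_C _).pow M).ne_zero h1.symm

/-- The coordinate vectors of the solutions `I^m(z)` are linearly independent over `𝕂(z)`. -/
theorem linearIndependent_toKz_Pvec {M N : ℕ} (hM0 : 0 < M) (hMp : M < p)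
    (hnp : k * q + 1 ≤ p) (hN : N * p ≤ (k * q + 1) * M) :
    LinearIndependent (𝕂 p q k) fun (m : Fin N) (j : Fin (k * q + 1)) =>
      toKz p (k * q + 1) (Pvec p (fun _ => M) ((N - (m + 1)) * p + p - 1) j) := by
  have hp := (Fact.out : p.Prime).pos
  rw [Fintype.linearIndependent_iff]
  intro c hc m₀
  have hN0 : 1 ≤ N := by have := m₀.2; omega
  have hNp : N * p = (N - 1) * p + p := by
    rw [← Nat.succ_mul, Nat.succ_eq_add_one, Nat.sub_add_cancel hN0]
  -- The shift by `mp` moves the coefficient defining the `m`-th vector to the single position `Np -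
  -- 1`.
  obtain ⟨G, hG⟩ : ∃ G : (𝕂 p q k)[X], G = ∑ m : Fin N, C (c m) * X ^ ((m : ℕ) * p) := ⟨_, rfl⟩
  have hcoeff : ∀ (Q : (𝕂 p q k)[X]), (Q * G).coeff (N * p - 1) =
      ∑ m : Fin N, c m * Q.coeff ((N - (m + 1)) * p + p - 1) := by
    intro Q
    rw [hG, Finset.mul_sum, finsetSum_coeff]
    refine Finset.sum_congr rfl fun m _ => ?_
    obtain ⟨e, he⟩ : ∃ e, N = m + 1 + e := ⟨N - (m + 1), by omega⟩
    rw [mul_left_comm, coeff_C_mul, coeff_mul_X_pow']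
    have h1 : N * p = m * p + p + e * p := by
      conv_lhs => rw [he]
      ring
    have h2 : N - (m + 1) = e := by omega
    rw [if_pos (by omega), h2]
    congr 2
    omega
  have hj : ∀ j, (F p q k ^ (M - 1) * (∏ i ∈ Finset.univ.erase j, (X - C (z p q k i))) *
      G).coeff (N * p - 1) = 0 := by
    intro j
    rw [← map_Pcoord p q k hM0, hcoeff]
    have := congrFun hc j
    simpa only [Finset.sum_apply, Pi.smul_apply, smul_eq_mul, coeff_map, Pvec, Pi.zero_apply]
      using this
  have hu : ∀ u : (𝕂 p q k)[X], u.degree < (k * q + 1 : ℕ) →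
      (F p q k ^ (M - 1) * u * G).coeff (N * p - 1) = 0 := by
    intro u hu
    obtain ⟨d, rfl⟩ := exists_eq_sum_prod_erase (z_injective p q k) hu
    rw [Finset.mul_sum, Finset.sum_mul, finsetSum_coeff]
    refine Finset.sum_eq_zero fun j _ => ?_
    rw [mul_left_comm, mul_assoc (C _), coeff_C_mul, hj, mul_zero]
  have hpchar : (p : 𝕂 p q k) = 0 := CharP.cast_eq_zero _ p
  have hG0 : G = 0 := by
    refine eq_zero_of_coeff_pow_mul_eq_zero (F_monic p q k) (F_separable p q k) (M := M - 1)
      (s := N * p) ?_ ?_ ?_ ?_ ?_ ?_ ?_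
    · intro i hi1 hi2
      rw [Ne, CharP.cast_eq_zero_iff (𝕂 p q k) p]
      exact fun h => absurd (Nat.le_of_dvd (by omega) h) (by omega)
    · rw [F_natDegree]
      omega
    · rwa [F_natDegree, Nat.sub_add_cancel hM0]
    · rw [Nat.cast_mul, hpchar, mul_zero]
    · rw [hG, derivative_sum]
      refine Finset.sum_eq_zero fun m _ => ?_
      rw [derivative_C_mul_X_pow, Nat.cast_mul, hpchar]
      simp
    · rw [hG]
      have hlt : (N - 1) * p < N * p := by omega
      refine lt_of_le_of_lt (natDegree_sum_le_of_forall_le _ _ fun m _ => ?_) hlt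
      refine (natDegree_C_mul_X_pow_le _ _).trans (Nat.mul_le_mul_right p ?_)
      have := m.2
      omega
    · intro i hi1 hi2
      rw [F_natDegree] at hi1
      -- Testing against `1, x, …, x^(n-1)` reads off `n` consecutive coefficients of `F^(M-1) G`.
      have h1 := hu (X ^ (N * p - 1 - i)) (by
        rw [degree_X_pow]
        exact_mod_cast (show N * p - 1 - i < k * q + 1 by omega))
      rw [mul_right_comm, coeff_mul_X_pow', if_pos (by omega)] at h1
      rwa [show N * p - 1 - (N * p - 1 - i) = i by omega] at h1
  have h1 := congrArg (coeff · ((m₀ : ℕ) * p)) hG0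
  simp only [hG, finsetSum_coeff, coeff_C_mul, coeff_X_pow, coeff_zero] at h1
  rw [Finset.sum_eq_single m₀] at h1
  · simpa using h1
  · intro j _ hj
    rw [if_neg, mul_zero]
    intro h
    exact hj (Fin.ext (Nat.eq_of_mul_eq_mul_right hp h).symm)
  · simp

/-- The module of arithmetic solutions is generated by the `I^m(z)`. -/
theorem solModule_eq_span {M N : ℕ} {n : ℕ} (hMbar : Mbar (n := n) p q (fun _ => 1) = fun _ => M)
    (hM0 : 0 < M) (hN : n * M < (N + 1) * p) :
    solModule p q (fun _ : Fin n => 1) = Submodule.span (Fzp p n)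
      (Set.range fun m : Fin N => Pvec (n := n) p (fun _ => M) ((N - (m + 1)) * p + p - 1)) := by
  have hp := (Fact.out : p.Prime).pos
  rw [solModule, hMbar]
  apply le_antisymm
  · rw [Submodule.span_le]
    rintro _ ⟨l, hl, rfl⟩
    rcases le_or_gt l N with hlN | hlN
    · refine Submodule.subset_span ⟨⟨N - l, by omega⟩, ?_⟩
      obtain ⟨e, rfl⟩ : ∃ e, l = e + 1 := ⟨l - 1, by omega⟩
      have h1 : N - (N - (e + 1) + 1) = e := by omega
      simp only [h1]
      congr 1
      rw [Nat.succ_mul]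
    -- For `l > N` the index `lp - 1` exceeds the degree of every `P_j`.
    · have : Pvec p (fun _ : Fin n => M) (l * p - 1) = 0 := by
        funext j
        have h1 : (N + 1) * p ≤ l * p := Nat.mul_le_mul_right p hlN
        have h2 := natDegree_Pcoord_le (p := p) hM0 j
        have h3 : 0 < n * M := Nat.mul_pos (Nat.pos_of_ne_zero (by have := j.2; omega)) hM0
        exact coeff_eq_zero_of_natDegree_lt (by omega)
      rw [this]
      exact Submodule.zero_mem _
  · refine Submodule.span_mono ?_
    rintro _ ⟨m, rfl⟩
    refine ⟨N - (m + 1) + 1, by omega, ?_⟩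
    rw [Nat.succ_mul]

end SolutionVectors

/-! ### Semilinear isomorphisms onto an image. -/

section Semilinear

variable {K V W : Type*} [Field K] [AddCommGroup V] [Module K V] [AddCommGroup W] [Module K W]

/-- An injective semilinear map with image `S` is a semilinear isomorphism onto `S`. -/
theorem exists_semilinearEquiv {σ τ : K →+* K} [RingHomInvPair σ τ] [RingHomInvPair τ σ]
    (f : V →ₛₗ[σ] W) (S : Submodule K W) (hinj : Function.Injective f) (hmem : ∀ v, f v ∈ S)
    (hsurj : ∀ s ∈ S, ∃ v, f v = s) : ∃ e : V ≃ₛₗ[σ] S, ∀ v, (e v : W) = f v :=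
  ⟨LinearEquiv.ofBijective (f.codRestrict S hmem)
    ⟨fun _ _ h => hinj (congrArg Subtype.val h), fun s => by
      obtain ⟨v, hv⟩ := hsurj s s.2
      exact ⟨v, Subtype.ext hv⟩⟩, fun _ => rfl⟩

end Semilinear

/-! ### The adjoint Cartier map in coordinates. -/

section Adjoint

variable {p q k a₁ : ℕ} [Fact p.Prime] [Fact q.Prime]
  (w : Module.Basis (Fin (k * q + 1)) (𝕂 p q k) (W p q k))
  (b : Module.Basis (Fin (a₁ * k)) (𝕂 p q k) (OmegaEig p q k a₁))

theorem ofCoord_apply_basis (v : Fin (k * q + 1) → Fz p (k * q + 1)) (j : Fin (k * q + 1)) :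
    ofCoord w v (w j) = toKz p (k * q + 1) (v j) := by
  simp [ofCoord, Finsupp.single_apply]

theorem ofCoord_sum_smul {ι : Type*} [Fintype ι] (c : ι → Fzp p (k * q + 1))
    (v : ι → Fin (k * q + 1) → Fz p (k * q + 1)) :
    ofCoord w (∑ m, c m • v m) =
      ∑ m, toKz p (k * q + 1) (c m : Fz p (k * q + 1)) • ofCoord w (v m) := by
  refine w.ext fun j => ?_
  rw [ofCoord_apply_basis, LinearMap.sum_apply, Finset.sum_apply, map_sum]
  refine Finset.sum_congr rfl fun m _ => ?_
  rw [LinearMap.smul_apply, ofCoord_apply_basis, smul_eq_mul, ← map_mul]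
  rfl

/-- The adjoint of the Cartier map in coordinates. -/
theorem semilinearAdjoint_cartierMap (φ : Module.Dual (𝕂 p q k) (OmegaEig p q k a₁)) :
    semilinearAdjoint (σ := σ p (k * q + 1)) (cartierMap w b) φ =
      ∑ m, σ p (k * q + 1) (φ (b m)) • ofCoord w (Isol p q k a₁ (m + 1)) := by
  refine w.ext fun j => ?_
  have h : semilinearAdjoint (σ := σ p (k * q + 1)) (cartierMap w b) φ (w j) =
      σ p (k * q + 1) (φ (cartierMap w b (w j))) := rfl
  rw [h, cartierMap, semilinearOfBasis_apply, map_sum, map_sum, LinearMap.sum_apply]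
  refine Finset.sum_congr rfl fun m _ => ?_
  rw [map_smul, smul_eq_mul, map_mul, σ_τ, LinearMap.smul_apply, ofCoord_apply_basis, smul_eq_mul]
  exact mul_comm _ _

theorem semilinearAdjoint_cartierMap_coord (m : Fin (a₁ * k)) :
    semilinearAdjoint (σ := σ p (k * q + 1)) (cartierMap w b) (b.coord m) =
      ofCoord w (Isol p q k a₁ (m + 1)) := by
  rw [semilinearAdjoint_cartierMap, Finset.sum_eq_single m]
  · simp
  · intro j _ hj
    simp [hj.symm]
  · simp

theorem semilinearAdjoint_cartierMap_sum (c : Fin (a₁ * k) → 𝕂 p q k) :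
    semilinearAdjoint (σ := σ p (k * q + 1)) (cartierMap w b) (∑ m, c m • b.coord m) =
      ∑ m, σ p (k * q + 1) (c m) • ofCoord w (Isol p q k a₁ (m + 1)) := by
  rw [map_sum]
  exact Finset.sum_congr rfl fun m _ => by
    rw [LinearMap.map_smulₛₗ, semilinearAdjoint_cartierMap_coord]

theorem semilinearAdjoint_cartierMap_injective
    (hli : LinearIndependent (𝕂 p q k) fun (m : Fin (a₁ * k)) (j : Fin (k * q + 1)) =>
      toKz p (k * q + 1) (Isol p q k a₁ (m + 1) j)) :
    Function.Injective (semilinearAdjoint (σ := σ p (k * q + 1)) (cartierMap w b)) := by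
  rw [injective_iff_map_eq_zero]
  intro φ hφ
  rw [semilinearAdjoint_cartierMap] at hφ
  rw [Fintype.linearIndependent_iff] at hli
  refine b.ext fun m => (map_eq_zero (σ p (k * q + 1))).1 (hli (fun m => σ _ _ (φ (b m))) ?_ m)
  funext j
  have := LinearMap.congr_fun hφ (w j)
  rw [LinearMap.sum_apply] at this
  simpa [ofCoord_apply_basis] using this

end Adjoint

/-- The arithmetic solutions `I^m(z)` form a basis of the module they generate. -/
theorem exists_basis_solModule {p q k a₁ : ℕ} [Fact p.Prime]
    (hli : LinearIndependent (𝕂 p q k) fun (m : Fin (a₁ * k)) (j : Fin (k * q + 1)) =>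
      toKz p (k * q + 1) (Isol p q k a₁ (m + 1) j))
    (hspan : solModule p q (fun _ : Fin (k * q + 1) => 1) =
      Submodule.span (Fzp p (k * q + 1)) (Set.range fun m : Fin (a₁ * k) =>
        Isol p q k a₁ (m + 1))) :
    ∃ I : Module.Basis (Fin (a₁ * k)) (Fzp p (k * q + 1))
        (solModule p q (fun _ : Fin (k * q + 1) => 1)),
      ∀ m, (I m : Fin (k * q + 1) → Fz p (k * q + 1)) = Isol p q k a₁ (m + 1) := by
  have hli' : LinearIndependent (Fzp p (k * q + 1)) fun m : Fin (a₁ * k) =>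
      Isol p q k a₁ (m + 1) := by
    rw [Fintype.linearIndependent_iff] at hli ⊢
    intro c hc m
    have h1 := hli (fun m => toKz p (k * q + 1) (c m : Fz p (k * q + 1))) (by
      funext j
      have h2 := congrArg (toKz p (k * q + 1)) (congrFun hc j)
      rw [Finset.sum_apply, map_sum, Pi.zero_apply, map_zero] at h2
      rw [Finset.sum_apply, Pi.zero_apply, ← h2]
      refine Finset.sum_congr rfl fun m _ => ?_
      exact (map_mul _ _ _).symm) m
    exact Subtype.ext (toKz_injective p _ (h1.trans (map_zero _).symm))
  refine ⟨(Module.Basis.span hli').map (LinearEquiv.ofEq _ _ hspan.symm), fun m => ?_⟩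
  rw [Module.Basis.map_apply, LinearEquiv.coe_ofEq_apply]
  exact congrArg Subtype.val (Module.Basis.span_apply hli' m)

end ArithSol

end

/-! ### The main theorem. -/

open ArithSol in
set_option maxHeartbeats 1000000 in
theorem theorem6p1 (p q k a₁ : ℕ) [Fact p.Prime] [Fact q.Prime]
    (hk : 0 < k) (hp : k * q + 1 < p)
    (ha_pos : 1 ≤ a₁) (ha_lt : a₁ < q) (ha : a₁ * p ≡ 1 [MOD q]) :
    ∃ (w : Module.Basis (Fin (k * q + 1)) (ArithSol.𝕂 p q k) (ArithSol.W p q k))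
      (b : Module.Basis (Fin (a₁ * k)) (ArithSol.𝕂 p q k) (ArithSol.OmegaEig p q k a₁))
      (I : Module.Basis (Fin (a₁ * k)) (ArithSol.Fzp p (k * q + 1))
        (ArithSol.solModule p q (fun _ : Fin (k * q + 1) => 1)))
      (ι : Module.Dual (ArithSol.𝕂 p q k) (ArithSol.OmegaEig p q k a₁)
        ≃ₛₗ[ArithSol.σ p (k * q + 1)]
          Submodule.span (ArithSol.𝕂 p q k) (ArithSol.ofCoord w ''
            (ArithSol.solModule p q (fun _ : Fin (k * q + 1) => 1) :
              Set (Fin (k * q + 1) → ArithSol.Fz p (k * q + 1))))),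
      -- the bases of `W(X)`, of `Ω¹_{a₁}(X)` and of the module of arithmetic solutions
      (∀ j, (w j : ArithSol.Forms p q k) = ArithSol.wForm p q k j) ∧
      (∀ m, (b m : ArithSol.Forms p q k) = ArithSol.omegaForm p q k a₁ (a₁ * k - (m + 1))) ∧
      (∀ m, (I m : Fin (k * q + 1) → ArithSol.Fz p (k * q + 1)) =
        ArithSol.Isol p q k a₁ (m + 1)) ∧
      -- the dimension and the rank
      Module.finrank (ArithSol.𝕂 p q k)
        (Module.Dual (ArithSol.𝕂 p q k) (ArithSol.OmegaEig p q k a₁)) = a₁ * k ∧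
      Module.finrank (ArithSol.Fzp p (k * q + 1))
        (ArithSol.solModule p q (fun _ : Fin (k * q + 1) => 1)) = a₁ * k ∧
      -- `ι` is the adjoint of the Cartier map, and it sends `φ^m` to `I^m(z)`
      (∀ φ, (ι φ : Module.Dual (ArithSol.𝕂 p q k) (ArithSol.W p q k)) =
        ArithSol.semilinearAdjoint (σ := ArithSol.σ p (k * q + 1))
          (ArithSol.cartierMap w b) φ) ∧
      (∀ m, (ι (b.coord m) : Module.Dual (ArithSol.𝕂 p q k) (ArithSol.W p q k)) =
        ArithSol.ofCoord w (ArithSol.Isol p q k a₁ (m + 1))) ∧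
      -- it maps the `𝔽_p[z]`-span of the `φ^m` bijectively onto the module of arithmetic solutions
      Set.BijOn (fun φ => (ι φ : Module.Dual (ArithSol.𝕂 p q k) (ArithSol.W p q k)))
        {φ | ∃ c : Fin (a₁ * k) → ArithSol.Fz p (k * q + 1),
          φ = ∑ m, ArithSol.toKz p (k * q + 1) (c m) • b.coord m}
        (ArithSol.ofCoord w '' (ArithSol.solModule p q (fun _ : Fin (k * q + 1) => 1) :
          Set (Fin (k * q + 1) → ArithSol.Fz p (k * q + 1)))) := by
  have hq := (Fact.out : q.Prime).pos
  have hqk : q ≤ k * q := Nat.le_mul_of_pos_left q hk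
  have hpq : p ≠ q := by omega
  obtain ⟨M, hM⟩ : ∃ M, q * M + 1 = a₁ * p := by
    have h1 : 1 ≤ a₁ * p := Nat.mul_pos ha_pos (Fact.out : p.Prime).pos
    obtain ⟨M, hM⟩ := (Nat.modEq_iff_dvd' h1).1 ha.symm
    exact ⟨M, by omega⟩
  -- From `qM + 1 = a₁p ≥ p > kq + 1`.
  have hkM : k < M := by
    have h1 : p ≤ a₁ * p := Nat.le_mul_of_pos_left p ha_pos
    have h2 : q * k < q * M := by rw [mul_comm q k]; omega
    exact lt_of_mul_lt_mul_left h2 (Nat.zero_le q)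
  have hMp : M < p := by
    have h1 : a₁ * p < q * p := Nat.mul_lt_mul_of_pos_right ha_lt (Fact.out : p.Prime).pos
    exact lt_of_mul_lt_mul_left (show q * M < q * p by omega) (Nat.zero_le q)
  -- With `k < M < p` this gives `a₁kp ≤ nM < (a₁k + 1)p`: the lower bound serves independence, the
  -- upper one generation.
  have hdeg : (k * q + 1) * M + k = a₁ * k * p + M := by
    linear_combination k * hM
  have hMbar := Mbar_eq (n := k * q + 1) hpq ha_lt (by omega) hM
  have hIsol : ∀ m, Isol p q k a₁ m =
      Pvec p (fun _ => M) ((a₁ * k - m) * p + p - 1) := fun m => by rw [Isol, hMbar]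
  have hli : LinearIndependent (𝕂 p q k) fun (m : Fin (a₁ * k)) (j : Fin (k * q + 1)) =>
      toKz p (k * q + 1) (Isol p q k a₁ (m + 1) j) := by
    simp only [hIsol]
    exact linearIndependent_toKz_Pvec (by omega) hMp hp.le (by omega)
  have hspan : solModule p q (fun _ : Fin (k * q + 1) => 1) =
      Submodule.span (Fzp p (k * q + 1)) (Set.range fun m : Fin (a₁ * k) =>
        Isol p q k a₁ (m + 1)) := by
    simp only [hIsol]
    exact solModule_eq_span hMbar (by omega) (by
      have : (a₁ * k + 1) * p = a₁ * k * p + p := by ring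
      omega)
  obtain ⟨w, hw⟩ := exists_basis_W p q k hpq
  obtain ⟨b, hb⟩ := exists_basis_OmegaEig p q k hpq ha_pos ha_lt
  obtain ⟨I, hI⟩ := exists_basis_solModule hli hspan
  have hIsol_mem : ∀ m : Fin (a₁ * k), Isol p q k a₁ (m + 1) ∈
      solModule p q (fun _ : Fin (k * q + 1) => 1) := fun m => by
    rw [← hI]
    exact (I m).2
  -- every arithmetic solution is a combination of the `I^m(z)` with `p`-th powers as coefficients
  have hrepr : ∀ v ∈ solModule p q (fun _ : Fin (k * q + 1) => 1),
      ∃ d : Fin (a₁ * k) → Fz p (k * q + 1), ofCoord w v =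
        semilinearAdjoint (σ := σ p (k * q + 1)) (cartierMap w b)
          (∑ m, toKz p (k * q + 1) (d m) • b.coord m) := by
    intro v hv
    have h1 : v = ∑ m, I.repr ⟨v, hv⟩ m • Isol p q k a₁ (m + 1) := by
      have h2 := congrArg (Submodule.subtype _) (I.sum_repr ⟨v, hv⟩)
      rw [map_sum] at h2
      refine h2.symm.trans (Finset.sum_congr rfl fun m _ => ?_)
      rw [← hI]
      rfl
    -- The `p`-th roots of the coefficients lie in `𝔽_p[z]` and give the preimage.
    choose d hd using fun m => (mem_Fzp_iff p (k * q + 1) _).1 (I.repr ⟨v, hv⟩ m).2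
    refine ⟨d, ?_⟩
    rw [semilinearAdjoint_cartierMap_sum, h1, ofCoord_sum_smul]
    exact Finset.sum_congr rfl fun m _ => by rw [σ_toKz, hd]
  have hsum : ∀ c : Fin (a₁ * k) → Fz p (k * q + 1),
      semilinearAdjoint (σ := σ p (k * q + 1)) (cartierMap w b)
        (∑ m, toKz p (k * q + 1) (c m) • b.coord m) ∈ ofCoord w ''
          (solModule p q (fun _ : Fin (k * q + 1) => 1) :
            Set (Fin (k * q + 1) → Fz p (k * q + 1))) := by
    intro c
    refine ⟨∑ m, (⟨c m ^ p, (mem_Fzp_iff p _ _).2 ⟨c m, rfl⟩⟩ : Fzp p (k * q + 1)) •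
      Isol p q k a₁ (m + 1), Submodule.sum_mem _ fun m _ => Submodule.smul_mem _ _ (hIsol_mem m), ?_⟩
    rw [semilinearAdjoint_cartierMap_sum, ofCoord_sum_smul]
    exact Finset.sum_congr rfl fun m _ => by rw [σ_toKz]
  have hinj := semilinearAdjoint_cartierMap_injective w b hli
  have hmem : ∀ φ, semilinearAdjoint (σ := σ p (k * q + 1)) (cartierMap w b) φ ∈
      Submodule.span (𝕂 p q k) (ofCoord w ''
      (solModule p q (fun _ : Fin (k * q + 1) => 1) :
        Set (Fin (k * q + 1) → Fz p (k * q + 1)))) := by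
    intro φ
    rw [semilinearAdjoint_cartierMap]
    exact Submodule.sum_mem _ fun m _ => Submodule.smul_mem _ _
      (Submodule.subset_span ⟨_, hIsol_mem m, rfl⟩)
  have hsurj : ∀ ψ ∈ Submodule.span (𝕂 p q k) (ofCoord w ''
      (solModule p q (fun _ : Fin (k * q + 1) => 1) :
        Set (Fin (k * q + 1) → Fz p (k * q + 1)))),
      ∃ φ, semilinearAdjoint (σ := σ p (k * q + 1)) (cartierMap w b) φ = ψ := by
    intro ψ hψ
    induction hψ using Submodule.span_induction with
    | mem ψ h =>
      obtain ⟨v, hv, rfl⟩ := h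
      obtain ⟨d, hd⟩ := hrepr v hv
      exact ⟨_, hd.symm⟩
    | zero => exact ⟨0, map_zero _⟩
    | add ψ ψ' _ _ h h' =>
      obtain ⟨φ, rfl⟩ := h
      obtain ⟨φ', rfl⟩ := h'
      exact ⟨φ + φ', map_add _ _ _⟩
    | smul c ψ _ h =>
      obtain ⟨φ, rfl⟩ := h
      exact ⟨τ p (k * q + 1) c • φ, by rw [LinearMap.map_smulₛₗ, σ_τ]⟩
  obtain ⟨ι, hι⟩ := exists_semilinearEquiv _ _ hinj hmem hsurj
  refine ⟨w, b, I, ι, hw, hb, hI, ?_, ?_, hι, ?_, ?_, ?_, ?_⟩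
  · rw [Subspace.dual_finrank_eq, Module.finrank_eq_card_basis b, Fintype.card_fin]
  · rw [Module.finrank_eq_card_basis I, Fintype.card_fin]
  · intro m
    rw [hι, semilinearAdjoint_cartierMap_coord]
  · rintro _ ⟨c, rfl⟩
    simpa only [hι] using hsum c
  · intro φ _ φ' _ h
    simp only [hι] at h
    exact hinj h
  · rintro _ ⟨v, hv, rfl⟩
    obtain ⟨d, hd⟩ := hrepr v hv
    exact ⟨_, ⟨d, rfl⟩, (hι _).trans hd.symm⟩
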